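/- Let $\mathbb{N}=\{1,2,\ldots\}$. A renewal process is a binary process $\{X_t : t\ge 1\}$ such that $\{t : X_t=1\}=\{T_0,\,T_0+T_1,\,T_0+T_1+T_2,\ldots\}$, where $T_0,T_1,T_2,\ldots$ are independent $\mathbb{N}$-valued random variables and $T_1,T_2,\ldots$ are identically distributed with some law $\mu$ (the interarrival distribution). For $n\in\mathbb{N}$ let $\mathcal{P}_n$ be the collection of all joint distributions of $X^{n+1}=(X_1,\ldots,X_{n+1})$, where $\{X_t\}$ ranges over the stationary renewal processes whose interarrival distribution $\mu$ has finite mean, and let $$\mathsf{Risk}_{\mathsf{rnwl}}(n)=\inf_{Q_{X_{n+1}|X^n}}\ \sup_{P\in\mathcal{P}_n}\ \mathbb{E}_{P}\Big[\mathrm{KL}\big(P_{X_{n+1}|X^n}\,\big\|\,Q_{X_{n+1}|X^n}\big)\Big]$$ be the minimax prediction risk, where the infimum is over all conditional distributions $Q_{X_{n+1}|X^n}$ of $X_{n+1}$ given $X^n=(X_1,\ldots,X_n)$. Then there is an absolute constant $C>0$ such that, for every $n\ge 1$, $$\frac{1}{C\sqrt{n}}\ \le\ \mathsf{Risk}_{\mathsf{rnwl}}(n)\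 \le\ \frac{C}{\sqrt{n}}.$$ -/

import Mathlib

open MeasureTheory ProbabilityTheory
open scoped ENNReal

noncomputable section

/-- The average KL prediction risk of the predictor `Q` when the data are drawn from `P`:
the expectation, over `X^n`, of the KL divergence between the conditional law of `X_{n+1}` given
`X^n` and `Q(· | X^n)`.  A point of `Fin (n + 1) → S` is a trajectory `(X_1, …, X_{n+1})`;
`Fin.init` is its restriction to the first `n` coordinates. -/
def predictionRiskAt {S : Type*} [MeasurableSpace S] [StandardBorelSpace S] [Nonempty S] {n : ℕ}
    (Q : Kernel (Fin n → S) S) (P : ProbabilityMeasure (Fin (n + 1) → S)) : ℝ≥0∞ :=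
  ∫⁻ x : Fin (n + 1) → S,
    InformationTheory.klDiv
      (condDistrib (fun y : Fin (n + 1) → S => y (Fin.last n))
        (fun y : Fin (n + 1) → S => (Fin.init y : Fin n → S))
        (P : Measure (Fin (n + 1) → S)) (Fin.init x))
      (Q (Fin.init x)) ∂(P : Measure (Fin (n + 1) → S))

/-- The worst-case prediction risk of the predictor `Q` over the model class `𝓜`. -/
def worstCaseRisk {S : Type*} [MeasurableSpace S] [StandardBorelSpace S] [Nonempty S] {n : ℕ}
    (Q : Kernel (Fin n → S) S) (𝓜 : Set (ProbabilityMeasure (Fin (n + 1) → S))) : ℝ≥0∞ :=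
  ⨆ P ∈ 𝓜, predictionRiskAt Q P

/-- The minimax prediction risk of the model class `𝓜`: the infimum of the worst-case risk over
all conditional distributions `Q` of `X_{n+1}` given `X^n`. -/
def minimaxRisk {S : Type*} [MeasurableSpace S] [StandardBorelSpace S] [Nonempty S] {n : ℕ}
    (𝓜 : Set (ProbabilityMeasure (Fin (n + 1) → S))) : ℝ≥0∞ :=
  ⨅ (Q : Kernel (Fin n → S) S) (_ : IsMarkovKernel Q), worstCaseRisk Q 𝓜

/-- The joint law of `T_0, T_1, T_2, …`: independent, `T_0` with law `ν` and `T_i` with law `μ`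
for `i ≥ 1`. -/
def waitingTimesLaw (ν μ : PMF ℕ) : Measure (ℕ → ℕ) :=
  Measure.infinitePi (fun i : ℕ => (if i = 0 then ν else μ).toMeasure)

open Classical in
/-- The binary path with renewal times `T_0, T_0 + T_1, T_0 + T_1 + T_2, …`.  The process starts at
time `1`, so coordinate `t : ℕ` of the path is the symbol `X_{t+1}`. -/
def renewalPath (T : ℕ → ℕ) (t : ℕ) : Bool :=
  decide (∃ k : ℕ, ∑ i ∈ Finset.range (k + 1), T i = t + 1)

theorem measurable_renewalPath : Measurable renewalPath := by
  refine measurable_pi_lambda _ fun t => measurable_to_bool ?_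
  have h : (fun T : ℕ → ℕ => renewalPath T t) ⁻¹' {true}
      = ⋃ k : ℕ, {T : ℕ → ℕ | ∑ i ∈ Finset.range (k + 1), T i = t + 1} := by
    ext T
    simp [renewalPath]
  rw [h]
  refine MeasurableSet.iUnion fun k => ?_
  have hm : Measurable fun T : ℕ → ℕ => ∑ i ∈ Finset.range (k + 1), T i := by fun_prop
  exact hm (measurableSet_singleton (t + 1))

/-- The law of the renewal process with initial wait law `ν` and interarrival law `μ`. -/
def renewalLaw (ν μ : PMF ℕ) : Measure (ℕ → Bool) :=
  (waitingTimesLaw ν μ).map renewalPath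

/-- A process law is stationary if it is invariant under the time shift. -/
def IsStationaryLaw (P : Measure (ℕ → Bool)) : Prop :=
  P.map (fun (x : ℕ → Bool) (t : ℕ) => x (t + 1)) = P

/-- The joint distributions of `(X_1, …, X_{n+1})` for stationary renewal processes whose waiting
times are positive integers and whose interarrival law has finite mean. -/
def renewalClass (n : ℕ) : Set (ProbabilityMeasure (Fin (n + 1) → Bool)) :=
  {P | ∃ ν μ : PMF ℕ, ν 0 = 0 ∧ μ 0 = 0 ∧ (∑' t : ℕ, (t : ℝ≥0∞) * μ t) < ∞ ∧
    IsStationaryLaw (renewalLaw ν μ) ∧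
    (P : Measure (Fin (n + 1) → Bool)) =
      (renewalLaw ν μ).map (fun (x : ℕ → Bool) (i : Fin (n + 1)) => x i)}

/-- The optimal prediction risk for stationary renewal processes from `n` observed symbols. -/
def renewalRisk (n : ℕ) : ℝ≥0∞ :=
  minimaxRisk (renewalClass n)

end

/-! The path law is explicit: a word has probability equal to the product of the probabilities of
its completed waits times the tail of its current wait (`pathProb`, `renewalLaw_startSet`). Both
bounds then become finite sums over words.

Upper bound. After the first one, the likelihood depends only on the multiset of completed waits and
on the age, the number of zeros since the last one. The multisets have sum at most `n`, so by the
partition bound there are at most `exp (3 √n)` of them (`card_multiset_sum_le`). A code that is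
uniform over types and uniform within each type therefore has log-loss redundancy of order `√n` on
words of length `n + 1`. Averaging its conditional probabilities over all context lengths, and using
Jensen and stationarity, divides this redundancy by `n + 1` (`sum_pathProb_mul_log_le`). The law of
the first wait is not encoded. It is dropped from the likelihood, and the resulting loss only grows
with the context (`likelihoodLoss_take_le`), which is the direction the averaging needs.

Lower bound. Take `L` of order `√n` and interarrival laws that put mass `1 / (2 L)` on each of `2 L`
disjoint pairs of neighbouring waits in `[L, 5 L)`, the larger share of each pair being chosen
freely. Within time `n ≤ L ^ 2` a given pair goes unseen with probability bounded below
(`sum_prefixProb_of_hasGap_le`), and then the data cannot tell which share is larger. When the age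
reaches that pair, an event of probability of order `1 / L`, the two candidate hazards have squared
Hellinger distance of order `1 / L`. Each pair thus costs order `1 / L ^ 2`
(`ageLoss_add_ageLoss_ge`). Distinct pairs are met at distinct ages, so the costs of about `L / 4`
pairs add up to order `1 / L`, by averaging over all choices of shares (`mul_le_of_flip`). -/

open MeasureTheory ProbabilityTheory
open scoped ENNReal

/-! ### Binary words, their waits, and the probability of a word. -/

noncomputable section

/-- The finset of binary words of length `n`. -/
def words (n : ℕ) : Finset (List Bool) :=
  (Finset.univ : Finset (Fin n → Bool)).image fun x => (List.ofFn x).reverse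

theorem mem_words {n : ℕ} {l : List Bool} : l ∈ words n ↔ l.length = n := by
  constructor
  · intro h
    obtain ⟨x, -, rfl⟩ := Finset.mem_image.1 h
    simp
  · rintro rfl
    refine Finset.mem_image.2 ⟨fun i => l.reverse.get (i.cast (by simp)), Finset.mem_univ _, ?_⟩
    rw [List.reverse_eq_iff]
    apply List.ext_getElem <;> simp

theorem reverse_ofFn_injective (n : ℕ) :
    Function.Injective fun x : Fin n → Bool => (List.ofFn x).reverse := fun _ _ h =>
  List.ofFn_injective (List.reverse_injective h)

theorem sum_words_eq_sum_fin {β : Type*} [AddCommMonoid β] (n : ℕ) (F : List Bool → β) :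
    ∑ l ∈ words n, F l = ∑ x : Fin n → Bool, F (List.ofFn x).reverse := by
  rw [words, Finset.sum_image fun _ _ _ _ h => reverse_ofFn_injective n h]

theorem words_zero : words 0 = {[]} := by
  ext l; simp [mem_words]

theorem sum_words_succ {β : Type*} [AddCommMonoid β] (n : ℕ) (F : List Bool → β) :
    ∑ l ∈ words (n + 1), F l = ∑ l ∈ words n, (F (true :: l) + F (false :: l)) := by
  have : ∑ l ∈ words n, (F (true :: l) + F (false :: l))
      = ∑ p ∈ words n ×ˢ (Finset.univ : Finset Bool), F (p.2 :: p.1) := by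
    rw [Finset.sum_product]; simp
  rw [this]
  refine Finset.sum_bij' (fun l _ => (l.tail, l.headD true)) (fun p _ => p.2 :: p.1) ?_ ?_ ?_ ?_ ?_
  · intro l hl; simp [mem_words] at hl ⊢; omega
  · intro p hp; simp [mem_words] at hp ⊢; omega
  · intro l hl
    rw [mem_words] at hl
    cases l <;> simp at hl ⊢
  · intro p hp; simp
  · intro l hl
    rw [mem_words] at hl
    cases l <;> simp at hl ⊢

/-- The end of a list is its oldest symbol. `sum_words_succ` serves for conditioning on the past,
this version for stationarity. -/
theorem sum_words_succ_last {β : Type*} [AddCommMonoid β] (n : ℕ) (F : List Bool → β) :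
    ∑ l ∈ words (n + 1), F l = ∑ l ∈ words n, (F (l ++ [true]) + F (l ++ [false])) := by
  have h : ∀ (m : ℕ) (G : List Bool → β),
      ∑ l ∈ words m, G l = ∑ l ∈ words m, G l.reverse := by
    intro m G
    refine Finset.sum_bij' (fun l _ => l.reverse) (fun l _ => l.reverse) ?_ ?_ ?_ ?_ ?_ <;>
      simp [mem_words]
  rw [h, sum_words_succ, h n]
  simp

/-- The number of zeros since the last one (or since the start) in a word whose most recent symbol
comes first. -/
def age : List Bool → ℕ
  | [] => 0
  | true :: _ => 0
  | false :: l => age l + 1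

/-- The `i`-th waiting time read off a word whose most recent symbol comes first. -/
def gapAt : List Bool → ℕ → ℕ
  | [], _ => 0
  | true :: l, i => if i = l.count true then age l + 1 else gapAt l i
  | false :: l, i => gapAt l i

@[simp] theorem age_nil : age [] = 0 := rfl
@[simp] theorem age_true (l : List Bool) : age (true :: l) = 0 := rfl
@[simp] theorem age_false (l : List Bool) : age (false :: l) = age l + 1 := rfl

theorem age_le_length (l : List Bool) : age l ≤ l.length := by
  induction l with
  | nil => simp
  | cons b l ih => cases b <;> simp [ih]

theorem age_eq_length {l : List Bool} (h : l.count true = 0) : age l = l.length := by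
  induction l with
  | nil => simp
  | cons b l ih => cases b <;> simp_all

theorem age_lt_length {l : List Bool} (h : 0 < l.count true) : age l < l.length := by
  induction l with
  | nil => simp at h
  | cons b l ih => cases b <;> simp_all

theorem sum_gapAt (l : List Bool) :
    ∑ i ∈ Finset.range (l.count true), gapAt l i + age l = l.length := by
  induction l with
  | nil => simp
  | cons b l ih =>
    cases b
    · simpa [gapAt, ← add_assoc] using ih
    · simp only [List.count_cons_self, Finset.sum_range_succ, gapAt, if_true, age_true,
        List.length_cons]
      rw [Finset.sum_congr rfl fun i hi => if_neg (Finset.mem_range.1 hi).ne, ← ih]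
      ring

/-- The probability that a wait with law `μ` exceeds `a`. -/
def tailProb (μ : PMF ℕ) (a : ℕ) : ℝ := 1 - ∑ t ∈ Finset.range (a + 1), (μ t).toReal

theorem tailProb_eq_add (μ : PMF ℕ) (a : ℕ) :
    tailProb μ a = (μ (a + 1)).toReal + tailProb μ (a + 1) := by
  rw [tailProb, tailProb, Finset.sum_range_succ _ (a + 1)]; ring

theorem toMeasure_Ioi (μ : PMF ℕ) (a : ℕ) :
    μ.toMeasure (Set.Ioi a) = ENNReal.ofReal (tailProb μ a) := by
  have h1 : μ.toMeasure.real (Set.Ioi a) = tailProb μ a := by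
    have : Set.Ioi a = ((Finset.range (a + 1) : Finset ℕ) : Set ℕ)ᶜ := by
      ext; simp
    rw [this, probReal_compl_eq_one_sub (Finset.measurableSet _), tailProb, Measure.real,
      PMF.toMeasure_apply_finset, ENNReal.toReal_sum fun i _ => μ.apply_ne_top i]
  rw [← h1, ofReal_measureReal]

theorem tailProb_nonneg (μ : PMF ℕ) (a : ℕ) : 0 ≤ tailProb μ a := by
  have : ∑ t ∈ Finset.range (a + 1), μ t ≤ 1 := by
    rw [← μ.tsum_coe]; exact ENNReal.sum_le_tsum _
  rw [tailProb, ← ENNReal.toReal_sum fun i _ => μ.apply_ne_top i, sub_nonneg]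
  exact ENNReal.toReal_le_of_le_ofReal zero_le_one (by simpa using this)

theorem tailProb_zero {μ : PMF ℕ} (h : μ 0 = 0) : tailProb μ 0 = 1 := by
  simp [tailProb, h]

theorem tailProb_le_one (μ : PMF ℕ) (a : ℕ) : tailProb μ a ≤ 1 := by
  rw [tailProb, sub_le_self_iff]; positivity

/-- The law of the `i`-th waiting time. -/
def waitLaw (ν μ : PMF ℕ) (i : ℕ) : PMF ℕ := if i = 0 then ν else μ

theorem waitLaw_zero (ν μ : PMF ℕ) : waitLaw ν μ 0 = ν := rfl

theorem waitLaw_pos (ν μ : PMF ℕ) {i : ℕ} (h : 0 < i) : waitLaw ν μ i = μ := if_neg h.ne'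

/-- The probability that the completed waits of a renewal process are those of a word. -/
def prefixProb (ν μ : PMF ℕ) : List Bool → ℝ
  | [] => 1
  | true :: l => prefixProb ν μ l * (waitLaw ν μ (l.count true) (age l + 1)).toReal
  | false :: l => prefixProb ν μ l

/-- The probability that a renewal process starts with a given word, most recent symbol first. -/
def pathProb (ν μ : PMF ℕ) (l : List Bool) : ℝ :=
  prefixProb ν μ l * tailProb (waitLaw ν μ (l.count true)) (age l)

section
variable {ν μ : PMF ℕ}

theorem prefixProb_nonneg (l : List Bool) : 0 ≤ prefixProb ν μ l := by
  induction l with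
  | nil => simp [prefixProb]
  | cons b l ih => cases b <;> simp only [prefixProb] <;> positivity

theorem pathProb_nonneg (l : List Bool) : 0 ≤ pathProb ν μ l :=
  mul_nonneg (prefixProb_nonneg l) (tailProb_nonneg _ _)

theorem prefixProb_eq_prod (l : List Bool) :
    prefixProb ν μ l = ∏ i ∈ Finset.range (l.count true), (waitLaw ν μ i (gapAt l i)).toReal := by
  induction l with
  | nil => simp [prefixProb]
  | cons b l ih =>
    cases b
    · simpa [prefixProb, gapAt] using ih
    · simp only [prefixProb, List.count_cons_self, Finset.prod_range_succ, gapAt, if_true]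
      rw [ih]
      congr 1
      exact Finset.prod_congr rfl fun i hi => by rw [if_neg (Finset.mem_range.1 hi).ne]

/-- Right after a one the tail factor is that of a fresh interarrival wait at age zero, which is one
because `μ 0 = 0`. -/
theorem pathProb_cons_true (hμ : μ 0 = 0) (l : List Bool) :
    pathProb ν μ (true :: l) =
      prefixProb ν μ l * (waitLaw ν μ (l.count true) (age l + 1)).toReal := by
  rw [pathProb, List.count_cons_self, waitLaw_pos _ _ (Nat.succ_pos _), age_true,
    tailProb_zero hμ, mul_one, prefixProb]

theorem pathProb_cons_false (l : List Bool) :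
    pathProb ν μ (false :: l) =
      prefixProb ν μ l * tailProb (waitLaw ν μ (l.count true)) (age l + 1) := by
  simp [pathProb, prefixProb]

theorem pathProb_cons_add (hμ : μ 0 = 0) (l : List Bool) :
    pathProb ν μ (true :: l) + pathProb ν μ (false :: l) = pathProb ν μ l := by
  rw [pathProb_cons_true hμ, pathProb_cons_false, pathProb, tailProb_eq_add _ (age l)]
  ring

theorem pathProb_nil (hν : ν 0 = 0) : pathProb ν μ [] = 1 := by
  simp [pathProb, prefixProb, waitLaw, tailProb_zero hν]

theorem sum_pathProb (hν : ν 0 = 0) (hμ : μ 0 = 0) (n : ℕ) :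
    ∑ l ∈ words n, pathProb ν μ l = 1 := by
  induction n with
  | zero => simp [words_zero, pathProb_nil hν]
  | succ n ih => rw [sum_words_succ, Finset.sum_congr rfl fun l _ => pathProb_cons_add hμ l, ih]

end
end

/-! ### Cylinder probabilities of the renewal law, and stationarity expressed through them. -/

noncomputable section

/-- The paths that start with a given word, most recent symbol first. -/
def startSet : List Bool → Set (ℕ → Bool)
  | [] => Set.univ
  | b :: l => startSet l ∩ {x | x l.length = b}

theorem measurableSet_startSet (l : List Bool) : MeasurableSet (startSet l) := by
  induction l with
  | nil => exact MeasurableSet.univ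
  | cons b l ih =>
    exact ih.inter (measurableSet_eq_fun (measurable_pi_apply l.length) measurable_const)

theorem mem_startSet_ofFn {n : ℕ} (y : Fin n → Bool) (x : ℕ → Bool) :
    x ∈ startSet (List.ofFn y).reverse ↔ (fun i : Fin n => x i) = y := by
  induction n with
  | zero => simp [startSet, funext_iff]
  | succ n ih =>
    rw [List.ofFn_succ', List.concat_eq_append, List.reverse_append]
    simp only [List.reverse_cons, List.reverse_nil, List.nil_append, List.singleton_append,
      startSet, Set.mem_inter_iff, ih, Set.mem_ofPred_eq, List.length_reverse, List.length_ofFn,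
      funext_iff, Fin.forall_fin_succ']
    simp

theorem mem_startSet_append (l : List Bool) (c : Bool) (x : ℕ → Bool) :
    x ∈ startSet (l ++ [c]) ↔ x 0 = c ∧ (fun t => x (t + 1)) ∈ startSet l := by
  induction l with
  | nil => simp [startSet]
  | cons b l ih =>
    simp only [List.cons_append, startSet, Set.mem_inter_iff, ih, Set.mem_ofPred_eq,
      List.length_append, List.length_singleton, and_assoc]

theorem renewalPath_mem_startSet {T : ℕ → ℕ} (hT : ∀ i, 0 < T i) (l : List Bool) :
    renewalPath T ∈ startSet l ↔
      (∀ i < l.count true, T i = gapAt l i) ∧ age l < T (l.count true) := by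
  induction l with
  | nil => simp [startSet, hT]
  | cons b l ih =>
    have key : (∀ i < l.count true, T i = gapAt l i) → age l < T (l.count true) →
        (renewalPath T l.length = true ↔ T (l.count true) = age l + 1) := by
      intro h1 h2
      have h3 : ∑ i ∈ Finset.range (l.count true), T i + age l = l.length := by
        rw [← sum_gapAt l, Finset.sum_congr rfl fun i hi => h1 i (Finset.mem_range.1 hi)]
      have mono : StrictMono fun m => ∑ i ∈ Finset.range m, T i :=
        strictMono_nat_of_lt_succ fun m => by
          rw [Finset.sum_range_succ]; exact Nat.lt_add_of_pos_right (hT m)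
      have hdef : renewalPath T l.length = true ↔
          ∃ k, ∑ i ∈ Finset.range (k + 1), T i = l.length + 1 := by simp [renewalPath]
      rw [hdef]
      constructor
      · rintro ⟨k, hk⟩
        rcases lt_trichotomy (k + 1) (l.count true + 1) with h | h | h
        · have := mono.monotone (show k + 1 ≤ l.count true by omega)
          omega
        · rw [h, Finset.sum_range_succ] at hk
          omega
        · have := mono h
          dsimp only at this
          rw [Finset.sum_range_succ _ (l.count true)] at this
          omega
      · intro h
        exact ⟨l.count true, by rw [Finset.sum_range_succ]; omega⟩
    have h0 := hT (l.count true + 1)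
    cases b
    · simp only [startSet, Set.mem_inter_iff, ih, Set.mem_ofPred_eq, age_false, gapAt,
        List.count_cons_of_ne (show false ≠ true by simp)]
      constructor
      · rintro ⟨⟨h1, h2⟩, h3⟩
        have := key h1 h2
        rw [h3] at this
        exact ⟨h1, by simp at this; omega⟩
      · rintro ⟨h1, h2⟩
        have := key h1 (by omega)
        refine ⟨⟨h1, by omega⟩, ?_⟩
        rw [← Bool.not_eq_true, this]
        omega
    · simp only [startSet, Set.mem_inter_iff, ih, Set.mem_ofPred_eq, age_true, gapAt,
        List.count_cons_self]
      constructor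
      · rintro ⟨⟨h1, h2⟩, h3⟩
        refine ⟨fun i hi => ?_, h0⟩
        split_ifs with h
        · rw [h]; exact (key h1 h2).1 h3
        · exact h1 i (by omega)
      · rintro ⟨h1, -⟩
        have h2 : ∀ i < l.count true, T i = gapAt l i := fun i hi => by
          rw [h1 i (by omega), if_neg hi.ne]
        have h3 : T (l.count true) = age l + 1 := by
          rw [h1 _ (Nat.lt_succ_self _), if_pos rfl]
        exact ⟨⟨h2, by omega⟩, (key h2 (by omega)).2 h3⟩

variable {ν μ : PMF ℕ}

theorem waitingTimesLaw_eq (ν μ : PMF ℕ) :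
    waitingTimesLaw ν μ = Measure.infinitePi fun i => (waitLaw ν μ i).toMeasure := rfl

instance : IsProbabilityMeasure (waitingTimesLaw ν μ) := by
  rw [waitingTimesLaw_eq]; infer_instance

instance : IsProbabilityMeasure (renewalLaw ν μ) :=
  Measure.isProbabilityMeasure_map measurable_renewalPath.aemeasurable

theorem ae_waitingTimes_pos (hν : ν 0 = 0) (hμ : μ 0 = 0) :
    ∀ᵐ T ∂waitingTimesLaw ν μ, ∀ i, 0 < T i := by
  rw [ae_all_iff]
  intro i
  have h := Measure.infinitePi_map_eval (fun i => (waitLaw ν μ i).toMeasure) i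
  have h0 : (waitLaw ν μ i).toMeasure {0} = 0 := by
    rw [PMF.toMeasure_apply_singleton _ _ (measurableSet_singleton 0), waitLaw]
    split_ifs <;> assumption
  rw [← h, Measure.map_apply (measurable_pi_apply i) (measurableSet_singleton 0)] at h0
  rw [ae_iff, waitingTimesLaw_eq]
  convert h0 using 2
  ext T
  simp

theorem renewalLaw_startSet (hν : ν 0 = 0) (hμ : μ 0 = 0) (l : List Bool) :
    renewalLaw ν μ (startSet l) = ENNReal.ofReal (pathProb ν μ l) := by
  rw [renewalLaw, Measure.map_apply measurable_renewalPath (measurableSet_startSet l)]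
  set k := l.count true with hk
  -- The cylinder is, almost surely, a box in the first `k + 1` independent waits: `k` exact values
  -- and one exceedance.
  set S : ℕ → Set ℕ := fun i => if i < k then {gapAt l i} else Set.Ioi (age l) with hS
  have h1 : waitingTimesLaw ν μ (renewalPath ⁻¹' startSet l) =
      waitingTimesLaw ν μ (Set.pi (Finset.range (k + 1)) S) := by
    refine measure_congr ?_
    filter_upwards [ae_waitingTimes_pos hν hμ] with T hT
    refine propext ?_
    change renewalPath T ∈ startSet l ↔ T ∈ Set.pi (Finset.range (k + 1)) S
    rw [renewalPath_mem_startSet hT]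
    simp only [Set.mem_pi, Finset.coe_range, Set.mem_Iio, hS, ← hk]
    constructor
    · rintro ⟨h1, h2⟩ i hi
      split_ifs with h
      · exact h1 i h
      · obtain rfl : i = k := by omega
        exact h2
    · intro h
      refine ⟨fun i hi => ?_, ?_⟩
      · have := h i (by omega)
        rwa [if_pos hi] at this
      · have := h k (by omega)
        rwa [if_neg (lt_irrefl k)] at this
  rw [h1, waitingTimesLaw_eq, Measure.infinitePi_pi _ fun _ _ => MeasurableSet.of_discrete,
    Finset.prod_range_succ, pathProb, ENNReal.ofReal_mul (prefixProb_nonneg l), prefixProb_eq_prod,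
    ENNReal.ofReal_prod_of_nonneg fun _ _ => ENNReal.toReal_nonneg, ← hk]
  congr 1
  · refine Finset.prod_congr rfl fun i hi => ?_
    simp only [hS]
    rw [if_pos (Finset.mem_range.1 hi), ENNReal.ofReal_toReal (PMF.apply_ne_top _ _),
      PMF.toMeasure_apply_singleton _ _ (measurableSet_singleton _)]
  · simp only [hS]
    rw [if_neg (lt_irrefl k), toMeasure_Ioi]

/-- The law of the first `n` symbols of the renewal process. -/
theorem renewalLaw_map_singleton (hν : ν 0 = 0) (hμ : μ 0 = 0) {n : ℕ} (y : Fin n → Bool) :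
    (renewalLaw ν μ).map (fun (x : ℕ → Bool) (i : Fin n) => x i) {y} =
      ENNReal.ofReal (pathProb ν μ (List.ofFn y).reverse) := by
  rw [Measure.map_apply (by fun_prop) (measurableSet_singleton y), ← renewalLaw_startSet hν hμ]
  congr 1
  ext x
  rw [mem_startSet_ofFn]
  rfl

theorem measurable_shift : Measurable fun (x : ℕ → Bool) (t : ℕ) => x (t + 1) := by fun_prop

theorem renewalLaw_map_shift_startSet (hν : ν 0 = 0) (hμ : μ 0 = 0) (l : List Bool) :
    (renewalLaw ν μ).map (fun (x : ℕ → Bool) (t : ℕ) => x (t + 1)) (startSet l) =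
      ENNReal.ofReal (pathProb ν μ (l ++ [true]) + pathProb ν μ (l ++ [false])) := by
  rw [Measure.map_apply measurable_shift (measurableSet_startSet l),
    ENNReal.ofReal_add (pathProb_nonneg _) (pathProb_nonneg _), ← renewalLaw_startSet hν hμ,
    ← renewalLaw_startSet hν hμ, ← measure_union _ (measurableSet_startSet _)]
  · congr 1
    ext x
    simp only [Set.mem_preimage, Set.mem_union, mem_startSet_append, ← or_and_right]
    cases x 0 <;> simp
  · rw [Set.disjoint_left]
    intro x h1 h2
    rw [mem_startSet_append] at h1 h2
    simp [h1.1] at h2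

theorem pathProb_append_of_isStationaryLaw (hν : ν 0 = 0) (hμ : μ 0 = 0)
    (h : IsStationaryLaw (renewalLaw ν μ)) (l : List Bool) :
    pathProb ν μ (l ++ [true]) + pathProb ν μ (l ++ [false]) = pathProb ν μ l := by
  have h1 := renewalLaw_map_shift_startSet hν hμ l
  rw [show (renewalLaw ν μ).map (fun (x : ℕ → Bool) (t : ℕ) => x (t + 1)) = _ from h,
    renewalLaw_startSet hν hμ, ENNReal.ofReal_eq_ofReal_iff (pathProb_nonneg _)
      (add_nonneg (pathProb_nonneg _) (pathProb_nonneg _))] at h1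
  exact h1.symm

/-- Every finite set of coordinates lies in an initial segment, so cylinders fix all
finite-dimensional marginals. Uniqueness of projective limits concludes. -/
theorem measure_path_ext {P P' : Measure (ℕ → Bool)} [IsFiniteMeasure P] [IsFiniteMeasure P']
    (h : ∀ l, P (startSet l) = P' (startSet l)) : P = P' := by
  have hfin : ∀ n : ℕ, P.map (fun (x : ℕ → Bool) (i : Fin n) => x i) =
      P'.map (fun (x : ℕ → Bool) (i : Fin n) => x i) := by
    intro n
    refine Measure.ext_of_singleton fun y => ?_
    have : (fun (x : ℕ → Bool) (i : Fin n) => x i) ⁻¹' {y} = startSet (List.ofFn y).reverse := by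
      ext x; rw [mem_startSet_ofFn]; rfl
    rw [Measure.map_apply (by fun_prop) (measurableSet_singleton y),
      Measure.map_apply (by fun_prop) (measurableSet_singleton y), this, h]
  refine IsProjectiveLimit.unique (P := fun I => P'.map I.restrict) (fun I => ?_) fun I => rfl
  have hI : ∀ i ∈ I, i < I.sup id + 1 := fun i hi => Nat.lt_succ_of_le (Finset.le_sup (f := id) hi)
  have hc : (I.restrict : (ℕ → Bool) → I → Bool) =
      (fun (y : Fin (I.sup id + 1) → Bool) (i : I) => y ⟨i, hI i i.2⟩) ∘
        fun (x : ℕ → Bool) (i : Fin (I.sup id + 1)) => x i := rfl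
  change P.map I.restrict = P'.map I.restrict
  rw [hc, ← Measure.map_map (by fun_prop) (by fun_prop),
    ← Measure.map_map (by fun_prop) (by fun_prop), hfin]

theorem isStationaryLaw_of_pathProb_append (hν : ν 0 = 0) (hμ : μ 0 = 0)
    (h : ∀ l, pathProb ν μ (l ++ [true]) + pathProb ν μ (l ++ [false]) = pathProb ν μ l) :
    IsStationaryLaw (renewalLaw ν μ) := by
  have : IsProbabilityMeasure
      ((renewalLaw ν μ).map (fun (x : ℕ → Bool) (t : ℕ) => x (t + 1))) :=
    Measure.isProbabilityMeasure_map measurable_shift.aemeasurable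
  refine measure_path_ext fun l => ?_
  rw [renewalLaw_map_shift_startSet hν hμ, h, renewalLaw_startSet hν hμ]

end

/-! ### Prediction risk as a finite sum over words. -/

noncomputable section

open InformationTheory in
-- The inequality `log √r ≥ 1 - 1 / √r` gives `r log r + 1 - r ≥ (√r - 1) ^ 2`. The lower bound
-- needs only this quadratic loss at a single symbol.
theorem sq_sqrt_sub_sqrt_le_klDiv (P Q : Measure Bool) [IsFiniteMeasure P]
    [IsFiniteMeasure Q] (b : Bool) :
    ENNReal.ofReal ((√(P.real {b}) - √(Q.real {b})) ^ 2) ≤ klDiv P Q := by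
  by_cases hac : P ≪ Q
  · rw [klDiv_eq_lintegral_klFun_of_ac hac, lintegral_fintype]
    refine le_trans ?_ (Finset.single_le_sum (fun _ _ => zero_le) (Finset.mem_univ b))
    set r := (P.rnDeriv Q b).toReal with hr
    have hr0 : 0 ≤ r := ENNReal.toReal_nonneg
    have hP : P.real {b} = r * Q.real {b} := by
      have h1 : P {b} = P.rnDeriv Q b * Q {b} := by
        conv_lhs => rw [← Measure.withDensity_rnDeriv_eq P Q hac]
        rw [withDensity_apply _ (measurableSet_singleton b), lintegral_singleton]
      rw [Measure.real, h1, ENNReal.toReal_mul]; rfl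
    have hk : (√r - 1) ^ 2 ≤ klFun r := by
      rw [klFun_apply]
      rcases hr0.eq_or_lt with h | h
      · simp [← h]
      · have h2 : 0 < √r := Real.sqrt_pos.2 h
        have h3 := Real.one_sub_inv_le_log_of_pos h2
        have h4 : Real.log r = 2 * Real.log √r := by
          rw [Real.log_sqrt hr0]; ring
        have h5 : √r * √r = r := Real.mul_self_sqrt hr0
        have h6 : r * (1 - (√r)⁻¹) = r - √r := by
          field_simp
          nlinarith
        nlinarith [mul_le_mul_of_nonneg_left h3 hr0]
    rw [← ofReal_measureReal (μ := Q) (s := {b}),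
      ← ENNReal.ofReal_mul (klFun_nonneg hr0)]
    refine ENNReal.ofReal_le_ofReal ?_
    rw [hP, Real.sqrt_mul hr0]
    calc (√r * √(Q.real {b}) - √(Q.real {b})) ^ 2
        = (√r - 1) ^ 2 * (√(Q.real {b}) * √(Q.real {b})) := by ring
      _ = (√r - 1) ^ 2 * Q.real {b} := by rw [Real.mul_self_sqrt measureReal_nonneg]
      _ ≤ _ := mul_le_mul_of_nonneg_right hk measureReal_nonneg
  · rw [klDiv_of_not_ac hac]; exact le_top

open InformationTheory in
theorem klDiv_bool_eq (P Q : Measure Bool) [IsProbabilityMeasure P] [IsProbabilityMeasure Q]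
    (hQ : ∀ b, 0 < Q.real {b}) :
    klDiv P Q = ENNReal.ofReal (∑ b, P.real {b} * Real.log (P.real {b} / Q.real {b})) ∧
      0 ≤ ∑ b, P.real {b} * Real.log (P.real {b} / Q.real {b}) := by
  have hac : P ≪ Q := by
    intro s hs
    have : s = ∅ := by
      refine Set.eq_empty_of_forall_notMem fun b hb => ?_
      have h1 : Q {b} = 0 := measure_mono_null (Set.singleton_subset_iff.2 hb) hs
      have h2 := hQ b
      rw [Measure.real, h1] at h2
      simp at h2
    simp [this]
  have hint : Integrable (llr P Q) P := .of_finite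
  have hsum : ∫ x, llr P Q x ∂P =
      ∑ b, P.real {b} * Real.log (P.real {b} / Q.real {b}) := by
    rw [integral_fintype hint]
    refine Finset.sum_congr rfl fun b _ => ?_
    have h1 : P {b} = P.rnDeriv Q b * Q {b} := by
      conv_lhs => rw [← Measure.withDensity_rnDeriv_eq P Q hac]
      rw [withDensity_apply _ (measurableSet_singleton b), lintegral_singleton]
    have h2 : P.real {b} / Q.real {b} = (P.rnDeriv Q b).toReal := by
      rw [div_eq_iff (hQ b).ne', Measure.real, h1, ENNReal.toReal_mul]; rfl
    rw [h2, smul_eq_mul, llr]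
  have h := toReal_klDiv_of_measure_eq hac (by rw [measure_univ, measure_univ])
  rw [hsum] at h
  rw [← h, ENNReal.ofReal_toReal (klDiv_ne_top hac hint)]
  exact ⟨rfl, ENNReal.toReal_nonneg⟩

variable {n : ℕ}

theorem reverse_ofFn_snoc (y : Fin n → Bool) (b : Bool) :
    (List.ofFn (Fin.snoc y b : Fin (n + 1) → Bool)).reverse = b :: (List.ofFn y).reverse := by
  rw [List.ofFn_succ', List.concat_eq_append, List.reverse_append]
  simp

theorem predictionRiskAt_eq_sum (Q : Kernel (Fin n → Bool) Bool)
    (P : ProbabilityMeasure (Fin (n + 1) → Bool)) :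
    predictionRiskAt Q P = ∑ y : Fin n → Bool,
      InformationTheory.klDiv
        (condDistrib (fun x : Fin (n + 1) → Bool => x (Fin.last n))
          (fun x : Fin (n + 1) → Bool => (Fin.init x : Fin n → Bool))
          (P : Measure (Fin (n + 1) → Bool)) y) (Q y) *
      (P : Measure (Fin (n + 1) → Bool)).map
        (fun x : Fin (n + 1) → Bool => (Fin.init x : Fin n → Bool)) {y} := by
  rw [predictionRiskAt, ← lintegral_fintype,
    lintegral_map (Measurable.of_discrete) (Measurable.of_discrete)]

/-- `P` gives the word `l`, most recent symbol first, the probability `w l`. -/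
structure HasWordLaw (P : Measure (Fin (n + 1) → Bool)) (w : List Bool → ℝ) : Prop where
  nonneg : ∀ l, 0 ≤ w l
  cons_add : ∀ l, w (true :: l) + w (false :: l) = w l
  singleton : ∀ x, P {x} = ENNReal.ofReal (w (List.ofFn x).reverse)

namespace HasWordLaw

variable {P : Measure (Fin (n + 1) → Bool)} {w : List Bool → ℝ}

theorem map_init (h : HasWordLaw P w) (y : Fin n → Bool) :
    P.map (fun x : Fin (n + 1) → Bool => (Fin.init x : Fin n → Bool)) {y} =
      ENNReal.ofReal (w (List.ofFn y).reverse) := by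
  rw [Measure.map_apply Measurable.of_discrete MeasurableSet.of_discrete]
  have : (fun x : Fin (n + 1) → Bool => (Fin.init x : Fin n → Bool)) ⁻¹' {y} =
      {(Fin.snoc y true : Fin (n + 1) → Bool)} ∪ {(Fin.snoc y false : Fin (n + 1) → Bool)} := by
    ext x
    simp only [Set.mem_preimage, Set.mem_singleton_iff, Set.mem_union]
    constructor
    · rintro rfl
      cases hb : x (Fin.last n)
      · right; rw [← hb, Fin.snoc_init_self]
      · left; rw [← hb, Fin.snoc_init_self]
    · rintro (rfl | rfl) <;> simp
  rw [this, measure_union _ MeasurableSet.of_discrete, h.singleton, h.singleton,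
    reverse_ofFn_snoc, reverse_ofFn_snoc, ← ENNReal.ofReal_add (h.nonneg _) (h.nonneg _),
    h.cons_add]
  rw [Set.disjoint_singleton]
  intro h1
  have := congrFun h1 (Fin.last n)
  simp at this

theorem condDistrib_real [IsFiniteMeasure P] (h : HasWordLaw P w) (y : Fin n → Bool)
    (hy : w (List.ofFn y).reverse ≠ 0) (b : Bool) :
    (condDistrib (fun x : Fin (n + 1) → Bool => x (Fin.last n))
      (fun x : Fin (n + 1) → Bool => (Fin.init x : Fin n → Bool)) P y).real {b} =
      w (b :: (List.ofFn y).reverse) / w (List.ofFn y).reverse := by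
  rw [Measure.real, condDistrib_apply_of_ne_zero Measurable.of_discrete, h.map_init,
    Measure.map_apply Measurable.of_discrete MeasurableSet.of_discrete]
  · have : (fun x : Fin (n + 1) → Bool => ((Fin.init x : Fin n → Bool), x (Fin.last n))) ⁻¹'
        ({y} ×ˢ {b}) = {(Fin.snoc y b : Fin (n + 1) → Bool)} := by
      ext x
      simp only [Set.mem_preimage, Set.mem_prod, Set.mem_singleton_iff]
      constructor
      · rintro ⟨rfl, rfl⟩; rw [Fin.snoc_init_self]
      · rintro rfl; simp
    rw [this, h.singleton, reverse_ofFn_snoc, ENNReal.toReal_mul, ENNReal.toReal_inv,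
      ENNReal.toReal_ofReal (h.nonneg _), ENNReal.toReal_ofReal (h.nonneg _), inv_mul_eq_div]
  · rw [h.map_init]
    simpa using lt_of_le_of_ne (h.nonneg _) hy.symm

end HasWordLaw

theorem sum_le_predictionRiskAt {w : List Bool → ℝ} (Q : Kernel (Fin n → Bool) Bool)
    [IsMarkovKernel Q] (P : ProbabilityMeasure (Fin (n + 1) → Bool))
    (h : HasWordLaw (P : Measure (Fin (n + 1) → Bool)) w) :
    ∑ y : Fin n → Bool, ENNReal.ofReal (w (List.ofFn y).reverse *
      (√(w (true :: (List.ofFn y).reverse) / w (List.ofFn y).reverse) - √((Q y).real {true})) ^ 2)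
      ≤ predictionRiskAt Q P := by
  rw [predictionRiskAt_eq_sum]
  refine Finset.sum_le_sum fun y _ => ?_
  rw [h.map_init, mul_comm, ENNReal.ofReal_mul (sq_nonneg _)]
  by_cases hy : w (List.ofFn y).reverse = 0
  · simp [hy]
  · rw [← h.condDistrib_real y hy]
    gcongr
    exact sq_sqrt_sub_sqrt_le_klDiv _ _ _

/-- The predictor that assigns the probability `q l b` to the symbol `b` after the word `l`. -/
def wordKernel (n : ℕ) (q : List Bool → Bool → ℝ) : Kernel (Fin n → Bool) Bool :=
  Kernel.ofFunOfCountable fun y =>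
    ∑ b : Bool, ENNReal.ofReal (q (List.ofFn y).reverse b) • Measure.dirac b

theorem wordKernel_singleton (q : List Bool → Bool → ℝ) (y : Fin n → Bool) (b : Bool) :
    wordKernel n q y {b} = ENNReal.ofReal (q (List.ofFn y).reverse b) := by
  change (∑ b : Bool, ENNReal.ofReal (q (List.ofFn y).reverse b) • Measure.dirac b) {b} = _
  cases b <;> simp

theorem isMarkovKernel_wordKernel {q : List Bool → Bool → ℝ} (hq : ∀ l b, 0 ≤ q l b)
    (hsum : ∀ l ∈ words n, q l true + q l false = 1) : IsMarkovKernel (wordKernel n q) := by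
  refine ⟨fun y => ⟨?_⟩⟩
  have hu : (Set.univ : Set Bool) = {true} ∪ {false} := by
    ext b; cases b <;> simp
  rw [hu, measure_union (by simp) MeasurableSet.of_discrete, wordKernel_singleton,
    wordKernel_singleton, ← ENNReal.ofReal_add (hq _ _) (hq _ _),
    hsum _ (mem_words.2 (by simp)), ENNReal.ofReal_one]

theorem predictionRiskAt_wordKernel_le {w : List Bool → ℝ} {q : List Bool → Bool → ℝ}
    (hq : ∀ l b, 0 ≤ q l b) (hpos : ∀ l ∈ words n, ∀ b, 0 < q l b)
    (hsum : ∀ l ∈ words n, q l true + q l false = 1)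
    (P : ProbabilityMeasure (Fin (n + 1) → Bool))
    (h : HasWordLaw (P : Measure (Fin (n + 1) → Bool)) w) :
    predictionRiskAt (wordKernel n q) P ≤ ENNReal.ofReal (∑ l ∈ words n, ∑ b,
      w (b :: l) * Real.log (w (b :: l) / w l / q l b)) := by
  have := isMarkovKernel_wordKernel hq hsum
  rw [predictionRiskAt_eq_sum, sum_words_eq_sum_fin]
  have key : ∀ y : Fin n → Bool, InformationTheory.klDiv
        (condDistrib (fun x : Fin (n + 1) → Bool => x (Fin.last n))
          (fun x : Fin (n + 1) → Bool => (Fin.init x : Fin n → Bool))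
          (P : Measure (Fin (n + 1) → Bool)) y) (wordKernel n q y) *
      (P : Measure (Fin (n + 1) → Bool)).map
        (fun x : Fin (n + 1) → Bool => (Fin.init x : Fin n → Bool)) {y} =
      ENNReal.ofReal (∑ b, w (b :: (List.ofFn y).reverse) *
        Real.log (w (b :: (List.ofFn y).reverse) / w (List.ofFn y).reverse /
          q (List.ofFn y).reverse b)) ∧ 0 ≤ ∑ b, w (b :: (List.ofFn y).reverse) *
        Real.log (w (b :: (List.ofFn y).reverse) / w (List.ofFn y).reverse /
          q (List.ofFn y).reverse b) := by
    intro y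
    have hyl : (List.ofFn y).reverse ∈ words n := mem_words.2 (by simp)
    rw [h.map_init]
    set l := (List.ofFn y).reverse with hl
    -- The conditional law is arbitrary on null contexts, but there both sides vanish.
    by_cases hy : w l = 0
    · have h1 := h.cons_add l
      have h2 := h.nonneg (true :: l)
      have h3 := h.nonneg (false :: l)
      have h4 : ∀ b, w (b :: l) = 0 := by
        intro b; cases b <;> linarith
      simp [hy, h4]
    · have hQ : ∀ b, (wordKernel n q y).real {b} = q l b := fun b => by
        rw [Measure.real, wordKernel_singleton, ENNReal.toReal_ofReal (hq _ _)]
      obtain ⟨h1, h2⟩ := klDiv_bool_eq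
        (condDistrib (fun x : Fin (n + 1) → Bool => x (Fin.last n))
          (fun x : Fin (n + 1) → Bool => (Fin.init x : Fin n → Bool))
          (P : Measure (Fin (n + 1) → Bool)) y) (wordKernel n q y)
        (fun b => by rw [hQ]; exact hpos l hyl b)
      simp only [hQ, h.condDistrib_real y hy, ← hl] at h1 h2
      have h3 : ∑ b, w (b :: l) * Real.log (w (b :: l) / w l / q l b) =
          (∑ b, w (b :: l) / w l * Real.log (w (b :: l) / w l / q l b)) * w l := by
        rw [Finset.sum_mul]
        refine Finset.sum_congr rfl fun b _ => ?_
        field_simp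
      rw [h1, h3, ENNReal.ofReal_mul h2]
      exact ⟨rfl, mul_nonneg h2 (h.nonneg l)⟩
  rw [ENNReal.ofReal_sum_of_nonneg fun y _ => (key y).2]
  exact (Finset.sum_congr rfl fun y _ => (key y).1).le

theorem hasWordLaw_of_eq_renewalLaw {ν μ : PMF ℕ} (hν : ν 0 = 0) (hμ : μ 0 = 0)
    {P : Measure (Fin (n + 1) → Bool)}
    (hP : P = (renewalLaw ν μ).map (fun (x : ℕ → Bool) (i : Fin (n + 1)) => x i)) :
    HasWordLaw P (pathProb ν μ) where
  nonneg := pathProb_nonneg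
  cons_add := pathProb_cons_add hμ
  singleton x := by rw [hP, renewalLaw_map_singleton hν hμ]

end

/-! ### Partition bound, likelihood without the first wait, and type classes. -/

noncomputable section

/-- Expand the logarithms and sum over `j` first: with `q = 1 / (1 + s)`, the `k`-th term is at most
`1 / (k (q⁻ᵏ - 1))`, and Bernoulli bounds this by `1 / (s k ^ 2)`. The sum is then at most `π ^ 2 /
(6 s)`. -/
theorem sum_neg_log_one_sub_pow_le {s : ℝ} (hs : 0 < s) (n : ℕ) :
    ∑ j : Fin n, -Real.log (1 - ((1 + s)⁻¹) ^ (j.1 + 1)) ≤ 2 / s := by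
  set q := (1 + s)⁻¹ with hq
  have hq0 : 0 < q := by positivity
  have hq1 : q < 1 := inv_lt_one_of_one_lt₀ (by linarith)
  have h1 : HasSum (fun k : ℕ => ∑ j : Fin n, (q ^ (j.1 + 1)) ^ (k + 1) / ((k : ℝ) + 1))
      (∑ j : Fin n, -Real.log (1 - q ^ (j.1 + 1))) := by
    refine hasSum_sum fun j _ => Real.hasSum_pow_div_log_of_abs_lt_one ?_
    rw [abs_of_pos (by positivity)]
    exact pow_lt_one₀ hq0.le hq1 (Nat.succ_ne_zero _)
  have h2 : HasSum (fun k : ℕ => s⁻¹ * (1 / ((k + 1 : ℕ) : ℝ) ^ 2)) (s⁻¹ * (Real.pi ^ 2 / 6)) := by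
    refine HasSum.mul_left _ ?_
    rw [hasSum_nat_add_iff (f := fun k : ℕ => 1 / (k : ℝ) ^ 2)]
    simpa using hasSum_zeta_two
  have h3 : s⁻¹ * (Real.pi ^ 2 / 6) ≤ 2 / s := by
    have : Real.pi ^ 2 / 6 ≤ 2 := by nlinarith [Real.pi_lt_d2, Real.pi_pos]
    rw [div_eq_inv_mul 2 s]
    gcongr
  refine (hasSum_le (fun k => ?_) h1 h2).trans h3
  rw [← Finset.sum_div, div_le_iff₀ (by positivity)]
  set y := q ^ (k + 1) with hy
  have hy0 : 0 < y := by positivity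
  have hy1 : y < 1 := pow_lt_one₀ hq0.le hq1 (Nat.succ_ne_zero _)
  have h4 : ∑ j : Fin n, (q ^ (j.1 + 1)) ^ (k + 1) ≤ y / (1 - y) := by
    have h5 : ∀ j : Fin n, (q ^ (j.1 + 1)) ^ (k + 1) = y * y ^ j.1 := by
      intro j; rw [hy, ← pow_mul, ← pow_mul, ← pow_add]; congr 1; ring
    rw [Finset.sum_congr rfl fun j _ => h5 j, ← Finset.mul_sum,
      Fin.sum_univ_eq_sum_range (fun i => y ^ i), div_eq_mul_inv]
    gcongr
    rw [geom_sum_eq hy1.ne, ← neg_div_neg_eq, neg_sub, neg_sub, div_eq_mul_inv]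
    have : 0 ≤ (1 - y)⁻¹ := inv_nonneg.2 (by linarith)
    nlinarith [pow_pos hy0 n]
  have h6 : ((k : ℝ) + 1) * s ≤ y⁻¹ - 1 := by
    have h7 := one_add_mul_le_pow (a := s) (by linarith) (k + 1)
    rw [hy, hq, inv_pow, inv_inv]
    push_cast at h7
    linarith
  have h8 : y / (1 - y) = (y⁻¹ - 1)⁻¹ := by
    have : 1 - y ≠ 0 := by linarith
    have h9 : y⁻¹ - 1 = (1 - y) / y := by field_simp
    rw [h9, inv_div]
  calc _ ≤ y / (1 - y) := h4
    _ = (y⁻¹ - 1)⁻¹ := h8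
    _ ≤ (((k : ℝ) + 1) * s)⁻¹ := inv_anti₀ (by positivity) h6
    _ = _ := by push_cast; field_simp

/-- The number of finite multisets of positive integers with sum at most `n` is at most
`exp (3 √n)`. -/
theorem card_multiset_sum_le {n : ℕ} (hn : 0 < n) (S : Finset (Multiset ℕ))
    (hS : ∀ m ∈ S, (∀ x ∈ m, 0 < x) ∧ m.sum ≤ n) :
    (S.card : ℝ) ≤ Real.exp (3 * √n) := by
  have hn' : (0 : ℝ) < n := by exact_mod_cast hn
  -- Generating function argument: the count is at most `q⁻ⁿ ∏ (1 - qʲ)⁻¹ ≤ exp (s n + 2 / s)`, and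
  -- this `s` makes both terms of order `√n`.
  set s : ℝ := (√n)⁻¹ with hs
  have hs0 : 0 < s := by positivity
  set q : ℝ := (1 + s)⁻¹ with hq
  have hq0 : 0 < q := by positivity
  have hq1 : q < 1 := inv_lt_one_of_one_lt₀ (by linarith)
  have hle : ∀ m ∈ S, ∀ x ∈ m, x ≤ n := fun m hm x hx =>
    (Multiset.single_le_sum (fun _ _ => Nat.zero_le _) x hx).trans (hS m hm).2
  have hsub : ∀ m ∈ S, m.toFinset ⊆ (Finset.univ : Finset (Fin n)).image fun j => j.1 + 1 := by
    intro m hm x hx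
    rw [Multiset.mem_toFinset] at hx
    have h1 := (hS m hm).1 x hx
    have h2 := hle m hm x hx
    exact Finset.mem_image.2 ⟨⟨x - 1, by omega⟩, Finset.mem_univ _, by simp; omega⟩
  have hsum : ∀ m ∈ S, m.sum = ∑ j : Fin n, m.count (j.1 + 1) * (j.1 + 1) := by
    intro m hm
    rw [Finset.sum_multiset_count_of_subset m _ (hsub m hm),
      Finset.sum_image fun a _ b _ h => Fin.ext (by simpa using h)]
    simp
  -- A multiset is encoded by its multiplicities, which turns the sum into part of an expanded
  -- product of geometric sums.
  have h1 : ∑ m ∈ S, q ^ m.sum ≤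
      ∑ c ∈ Fintype.piFinset fun _ : Fin n => Finset.range (n + 1),
        ∏ j : Fin n, (q ^ (j.1 + 1)) ^ c j := by
    have hinj : Set.InjOn (fun (m : Multiset ℕ) (j : Fin n) => m.count (j.1 + 1)) S := by
      intro m hm m' hm' h
      ext x
      by_cases hx : ∃ j : Fin n, j.1 + 1 = x
      · obtain ⟨j, rfl⟩ := hx
        exact congrFun h j
      · have h0 : ∀ m ∈ S, m.count x = 0 := fun m hm => by
          rw [Multiset.count_eq_zero]
          intro hxm
          have := hsub m hm (Multiset.mem_toFinset.2 hxm)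
          obtain ⟨j, -, hj⟩ := Finset.mem_image.1 this
          exact hx ⟨j, hj⟩
        rw [h0 m hm, h0 m' hm']
    calc ∑ m ∈ S, q ^ m.sum
        = ∑ c ∈ S.image (fun (m : Multiset ℕ) (j : Fin n) => m.count (j.1 + 1)),
            ∏ j : Fin n, (q ^ (j.1 + 1)) ^ c j := by
          rw [Finset.sum_image hinj]
          refine Finset.sum_congr rfl fun m hm => ?_
          rw [hsum m hm, ← Finset.prod_pow_eq_pow_sum]
          refine Finset.prod_congr rfl fun j _ => ?_
          rw [← pow_mul, mul_comm]
      _ ≤ _ := by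
          refine Finset.sum_le_sum_of_subset_of_nonneg ?_ fun _ _ _ => by positivity
          intro c hc
          obtain ⟨m, hm, rfl⟩ := Finset.mem_image.1 hc
          rw [Fintype.mem_piFinset]
          intro j
          rw [Finset.mem_range, Nat.lt_succ_iff]
          refine le_trans ?_ (hS m hm).2
          rw [hsum m hm]
          exact (Nat.le_mul_of_pos_right _ (Nat.succ_pos _)).trans
            (Finset.single_le_sum (f := fun j : Fin n => m.count (j.1 + 1) * (j.1 + 1))
              (fun _ _ => Nat.zero_le _) (Finset.mem_univ j))
  have h2 : ∑ c ∈ Fintype.piFinset fun _ : Fin n => Finset.range (n + 1),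
        ∏ j : Fin n, (q ^ (j.1 + 1)) ^ c j ≤ Real.exp (2 / s) := by
    rw [← Finset.prod_univ_sum (fun _ : Fin n => Finset.range (n + 1))
      (fun (j : Fin n) c => (q ^ (j.1 + 1)) ^ c)]
    have h3 := sum_neg_log_one_sub_pow_le hs0 n
    refine le_trans ?_ (Real.exp_le_exp.2 h3)
    rw [Real.exp_sum]
    refine Finset.prod_le_prod (fun _ _ => by positivity) fun j _ => ?_
    have hy0 : 0 < q ^ (j.1 + 1) := by positivity
    have hy1 : q ^ (j.1 + 1) < 1 := pow_lt_one₀ hq0.le hq1 (Nat.succ_ne_zero _)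
    rw [Real.exp_neg, Real.exp_log (by linarith), geom_sum_eq hy1.ne, ← neg_div_neg_eq, neg_sub,
      neg_sub, div_eq_mul_inv]
    have : 0 ≤ (1 - q ^ (j.1 + 1))⁻¹ := inv_nonneg.2 (by linarith)
    nlinarith [pow_pos hy0 (n + 1)]
  have h4 : (S.card : ℝ) * q ^ n ≤ ∑ m ∈ S, q ^ m.sum := by
    rw [← nsmul_eq_mul]
    exact Finset.card_nsmul_le_sum _ _ _ fun m hm =>
      pow_le_pow_of_le_one hq0.le hq1.le (hS m hm).2
  have h5 : (q ^ n)⁻¹ ≤ Real.exp (s * n) := by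
    rw [hq, inv_pow, inv_inv, mul_comm, Real.exp_nat_mul]
    exact pow_le_pow_left₀ (by positivity) (by linarith [Real.add_one_le_exp s]) n
  have h6 : (S.card : ℝ) ≤ Real.exp (2 / s) * (q ^ n)⁻¹ := by
    rw [← div_eq_mul_inv, le_div_iff₀ (by positivity)]
    exact h4.trans (h1.trans h2)
  have h7 : 2 / s + s * n = 3 * √n := by
    have : (n : ℝ) = √n * √n := (Real.mul_self_sqrt hn'.le).symm
    have h8 : s * n = √n := by
      rw [hs]; nth_rewrite 2 [this]; field_simp
    rw [h8, hs, div_inv_eq_mul]; ring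
  calc (S.card : ℝ) ≤ Real.exp (2 / s) * (q ^ n)⁻¹ := h6
    _ ≤ Real.exp (2 / s) * Real.exp (s * n) := by gcongr
    _ = _ := by rw [← Real.exp_add, h7]

/-- The completed waits of a word after its first one. -/
def gaps : List Bool → Multiset ℕ
  | [] => 0
  | true :: l => if l.count true = 0 then gaps l else (age l + 1) ::ₘ gaps l
  | false :: l => gaps l

theorem gaps_eq_zero {l : List Bool} (h : l.count true = 0) : gaps l = 0 := by
  induction l with
  | nil => rfl
  | cons b l ih => cases b <;> simp_all [gaps]

theorem gaps_pos (l : List Bool) : ∀ x ∈ gaps l, 0 < x := by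
  induction l with
  | nil => simp [gaps]
  | cons b l ih =>
    cases b
    · exact ih
    · rw [gaps]
      split_ifs
      · exact ih
      · intro x hx
        rcases Multiset.mem_cons.1 hx with rfl | hx
        · omega
        · exact ih x hx

theorem sum_gaps_add_age_le (l : List Bool) : (gaps l).sum + age l ≤ l.length := by
  induction l with
  | nil => simp [gaps]
  | cons b l ih =>
    cases b
    · simp only [gaps, age_false, List.length_cons]; omega
    · rw [gaps]
      split_ifs <;> simp <;> omega

/-- The likelihood of a word after its first one. -/
def likelihood (μ : PMF ℕ) (l : List Bool) : ℝ :=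
  ((gaps l).map fun g => (μ g).toReal).prod * if l.count true = 0 then 1 else tailProb μ (age l)

section
variable {ν μ : PMF ℕ}

theorem likelihood_of_count_eq_zero {l : List Bool} (h : l.count true = 0) :
    likelihood μ l = 1 := by
  rw [likelihood, if_pos h, gaps_eq_zero h]; simp

theorem likelihood_cons_of_count_eq_zero (hμ : μ 0 = 0) {l : List Bool} (h : l.count true = 0)
    (b : Bool) : likelihood μ (b :: l) = 1 := by
  cases b
  · exact likelihood_of_count_eq_zero (by simpa using h)
  · simp [likelihood, gaps, h, gaps_eq_zero h, tailProb_zero hμ]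

/-- The conditional probability of a symbol after `a` zeros, up to the factor `tailProb μ a`. -/
def stepMass (μ : PMF ℕ) (a : ℕ) (b : Bool) : ℝ :=
  if b then (μ (a + 1)).toReal else tailProb μ (a + 1)

theorem stepMass_le (a : ℕ) (b : Bool) : stepMass μ a b ≤ tailProb μ a := by
  have h1 := tailProb_nonneg μ (a + 1)
  have h2 : 0 ≤ (μ (a + 1)).toReal := ENNReal.toReal_nonneg
  rw [tailProb_eq_add, stepMass]; split_ifs <;> linarith

theorem likelihood_cons_of_count_pos (hμ : μ 0 = 0) {l : List Bool} (h : l.count true ≠ 0)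
    (b : Bool) : likelihood μ (b :: l) =
      ((gaps l).map fun g => (μ g).toReal).prod * stepMass μ (age l) b := by
  cases b
  · simp [likelihood, gaps, h, stepMass]
  · simp [likelihood, gaps, h, stepMass, tailProb_zero hμ]; ring

theorem likelihood_eq_of_count_pos {l : List Bool} (h : l.count true ≠ 0) :
    likelihood μ l = ((gaps l).map fun g => (μ g).toReal).prod * tailProb μ (age l) := by
  rw [likelihood, if_neg h]

theorem pathProb_cons_of_count_pos (hμ : μ 0 = 0) {l : List Bool} (h : l.count true ≠ 0)
    (b : Bool) : pathProb ν μ (b :: l) = prefixProb ν μ l * stepMass μ (age l) b := by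
  cases b
  · rw [pathProb_cons_false, waitLaw_pos _ _ (Nat.pos_of_ne_zero h)]; rfl
  · rw [pathProb_cons_true hμ, waitLaw_pos _ _ (Nat.pos_of_ne_zero h)]; rfl

theorem prod_gaps_nonneg (l : List Bool) : 0 ≤ ((gaps l).map fun g => (μ g).toReal).prod :=
  Multiset.prod_nonneg fun x hx => by
    obtain ⟨g, -, rfl⟩ := Multiset.mem_map.1 hx
    exact ENNReal.toReal_nonneg

theorem likelihood_nonneg (l : List Bool) : 0 ≤ likelihood μ l := by
  refine mul_nonneg (prod_gaps_nonneg l) ?_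
  split_ifs
  · exact zero_le_one
  · exact tailProb_nonneg _ _

theorem toReal_apply_le_one (μ : PMF ℕ) (t : ℕ) : (μ t).toReal ≤ 1 :=
  ENNReal.toReal_le_of_le_ofReal zero_le_one (by simpa using μ.coe_le_one t)

theorem prefixProb_le_prod_gaps (l : List Bool) :
    prefixProb ν μ l ≤ ((gaps l).map fun g => (μ g).toReal).prod := by
  induction l with
  | nil => simp [prefixProb, gaps]
  | cons b l ih =>
    cases b
    · exact ih
    · simp only [prefixProb, gaps]
      split_ifs with h
      · calc _ ≤ prefixProb ν μ l * 1 :=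
              mul_le_mul_of_nonneg_left (toReal_apply_le_one _ _) (prefixProb_nonneg l)
          _ ≤ _ := by simpa using ih
      · rw [waitLaw_pos _ _ (Nat.pos_of_ne_zero h), Multiset.map_cons, Multiset.prod_cons, mul_comm]
        exact mul_le_mul_of_nonneg_left ih ENNReal.toReal_nonneg

theorem pathProb_le_likelihood (l : List Bool) : pathProb ν μ l ≤ likelihood μ l := by
  by_cases h : l.count true = 0
  · have h1 := prefixProb_le_prod_gaps (ν := ν) (μ := μ) l
    rw [gaps_eq_zero h] at h1
    rw [likelihood_of_count_eq_zero h, pathProb]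
    exact mul_le_one₀ (by simpa using h1) (tailProb_nonneg _ _) (tailProb_le_one _ _)
  · rw [likelihood_eq_of_count_pos h, pathProb, waitLaw_pos _ _ (Nat.pos_of_ne_zero h)]
    exact mul_le_mul_of_nonneg_right (prefixProb_le_prod_gaps l) (tailProb_nonneg _ _)

theorem likelihood_cons_add (hμ : μ 0 = 0) (l : List Bool) :
    likelihood μ (true :: l) + likelihood μ (false :: l) =
      likelihood μ l + if l.count true = 0 then 1 else 0 := by
  by_cases h : l.count true = 0
  · rw [likelihood_cons_of_count_eq_zero hμ h, likelihood_cons_of_count_eq_zero hμ h,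
      likelihood_of_count_eq_zero h, if_pos h]
  · rw [likelihood_cons_of_count_pos hμ h, likelihood_cons_of_count_pos hμ h, if_neg h,
      likelihood_eq_of_count_pos h, tailProb_eq_add, stepMass, stepMass]
    simp; ring

/-- With the first wait forgotten, each possible time of the first one, and its absence, carries
total mass one. In the recursion the surplus comes from the all-zero word. -/
theorem sum_likelihood (hμ : μ 0 = 0) (n : ℕ) : ∑ l ∈ words n, likelihood μ l = n + 1 := by
  have hone : ∀ n : ℕ, ∑ l ∈ words n, (if l.count true = 0 then (1 : ℝ) else 0) = 1 := by
    intro n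
    induction n with
    | zero => rw [words_zero, Finset.sum_singleton]; simp
    | succ n ih => rw [sum_words_succ]; simpa using ih
  induction n with
  | zero => simp [words_zero, likelihood, gaps]
  | succ n ih =>
    rw [sum_words_succ, Finset.sum_congr rfl fun l _ => likelihood_cons_add hμ l,
      Finset.sum_add_distrib, ih, hone]
    push_cast; ring

/-- The words of length `n` with the same waits as `l`. -/
def typeClass (n : ℕ) (l : List Bool) : Finset (List Bool) :=
  (words n).filter fun l' => (gaps l', age l') = (gaps l, age l)

theorem typeClass_card_pos {n : ℕ} {l : List Bool} (hl : l ∈ words n) :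
    0 < (typeClass n l).card :=
  Finset.card_pos.2 ⟨l, Finset.mem_filter.2 ⟨hl, rfl⟩⟩

/-- The likelihood is constant on a type class, and the total over all words is `n + 1`. -/
theorem likelihood_mul_card_le (hμ : μ 0 = 0) {n : ℕ} {l : List Bool} (hl : l ∈ words n) :
    likelihood μ l * (typeClass n l).card ≤ n + 1 := by
  have h : ∀ l' ∈ typeClass n l, likelihood μ l' = likelihood μ l := by
    intro l' hl'
    obtain ⟨h1, h2⟩ := Finset.mem_filter.1 hl'
    obtain ⟨h3, h4⟩ := Prod.mk.inj h2
    rw [mem_words] at h1 hl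
    -- For words of equal length the age reveals whether a one has occurred: it equals the length
    -- exactly when none has.
    have h5 : l'.count true = 0 ↔ l.count true = 0 := by
      constructor <;> intro h
      · by_contra h0
        have := age_lt_length (Nat.pos_of_ne_zero h0)
        have := age_eq_length h
        omega
      · by_contra h0
        have := age_lt_length (Nat.pos_of_ne_zero h0)
        have := age_eq_length h
        omega
    rw [likelihood, likelihood, h3, h4]
    simp only [h5]
  rw [← sum_likelihood hμ n, mul_comm, ← nsmul_eq_mul, ← Finset.sum_const,
    ← Finset.sum_congr rfl h]
  exact Finset.sum_le_sum_of_subset_of_nonneg (Finset.filter_subset _ _)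
    fun _ _ _ => likelihood_nonneg _

/-- The sum counts the type classes, each given by a multiset of positive waits with sum at most `n`
and an age at most `n`. -/
theorem sum_inv_card_typeClass_le {n : ℕ} (hn : 0 < n) :
    ∑ l ∈ words n, ((typeClass n l).card : ℝ)⁻¹ ≤ (n + 1) * Real.exp (3 * √n) := by
  classical
  set g : List Bool → Multiset ℕ × ℕ := fun l => (gaps l, age l) with hg
  have h1 : ∑ l ∈ words n, ((typeClass n l).card : ℝ)⁻¹ = ((words n).image g).card := by
    have := Finset.sum_comp (s := words n)
      (fun b => (((words n).filter fun l' => g l' = b).card : ℝ)⁻¹) g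
    refine this.trans ?_
    rw [Finset.card_eq_sum_ones, Nat.cast_sum]
    refine Finset.sum_congr rfl fun b hb => ?_
    obtain ⟨l, hl, rfl⟩ := Finset.mem_image.1 hb
    rw [nsmul_eq_mul, Nat.cast_one, mul_inv_cancel₀]
    exact_mod_cast (typeClass_card_pos hl).ne'
  have h2 : (words n).image g ⊆ (words n).image gaps ×ˢ Finset.range (n + 1) := by
    intro b hb
    obtain ⟨l, hl, rfl⟩ := Finset.mem_image.1 hb
    refine Finset.mem_product.2 ⟨Finset.mem_image_of_mem _ hl, ?_⟩
    rw [Finset.mem_range, Nat.lt_succ_iff, ← mem_words.1 hl]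
    exact age_le_length l
  have h3 : (((words n).image gaps).card : ℝ) ≤ Real.exp (3 * √n) := by
    refine card_multiset_sum_le hn _ fun m hm => ?_
    obtain ⟨l, hl, rfl⟩ := Finset.mem_image.1 hm
    have := sum_gaps_add_age_le l
    rw [mem_words.1 hl] at this
    exact ⟨gaps_pos l, by omega⟩
  rw [h1]
  calc (((words n).image g).card : ℝ) ≤ (((words n).image gaps ×ˢ Finset.range (n + 1)).card : ℝ) :=
        by exact_mod_cast Finset.card_le_card h2
    _ = ((words n).image gaps).card * (n + 1) := by
        rw [Finset.card_product, Finset.card_range]; push_cast; rfl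
    _ ≤ _ := by rw [mul_comm]; gcongr

end
end

/-! ### The averaged type code and its regret. -/

noncomputable section

/-- The sum of `F` over the words that extend `l` by `k` more recent symbols. -/
def extensionSum (F : List Bool → ℝ) : ℕ → List Bool → ℝ
  | 0, l => F l
  | k + 1, l => extensionSum F k (true :: l) + extensionSum F k (false :: l)

theorem extensionSum_nonneg {F : List Bool → ℝ} (hF : ∀ l, 0 ≤ F l) (k : ℕ) (l : List Bool) :
    0 ≤ extensionSum F k l := by
  induction k generalizing l with
  | zero => exact hF l
  | succ k ih => exact add_nonneg (ih _) (ih _)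

theorem extensionSum_pos {F : List Bool → ℝ} {N : ℕ} (hF : ∀ l ∈ words N, 0 < F l) (k : ℕ)
    (l : List Bool) (hl : l.length + k = N) : 0 < extensionSum F k l := by
  induction k generalizing l with
  | zero => exact hF l (mem_words.2 (by simpa using hl))
  | succ k ih =>
    exact add_pos (ih _ (by rw [List.length_cons]; omega)) (ih _ (by rw [List.length_cons]; omega))

theorem sum_words_extensionSum (F : List Bool → ℝ) (m k : ℕ) :
    ∑ l ∈ words m, extensionSum F k l = ∑ l ∈ words (m + k), F l := by
  induction k generalizing m with
  | zero => rfl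
  | succ k ih =>
    rw [← add_assoc, add_right_comm, ← ih (m + 1), sum_words_succ]
    rfl

/-- The uniform-within-types code on words of length `N`, marginalized to words of length at most
`N`, up to normalization. -/
def typeCode (N : ℕ) (l : List Bool) : ℝ :=
  extensionSum (fun l => ((typeClass N l).card : ℝ)⁻¹) (N - l.length) l

theorem typeCode_nonneg (N : ℕ) (l : List Bool) : 0 ≤ typeCode N l :=
  extensionSum_nonneg (fun _ => by positivity) _ _

theorem typeCode_pos {N : ℕ} {l : List Bool} (hl : l.length ≤ N) : 0 < typeCode N l := by
  refine extensionSum_pos (N := N) (fun l hl => ?_) _ _ (by omega)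
  have := typeClass_card_pos hl
  positivity

theorem typeCode_cons_add {N : ℕ} {l : List Bool} (hl : l.length < N) :
    typeCode N (true :: l) + typeCode N (false :: l) = typeCode N l := by
  rw [typeCode, typeCode, typeCode, List.length_cons, List.length_cons,
    show N - l.length = N - (l.length + 1) + 1 by omega]
  rfl

theorem typeCode_of_mem_words {N : ℕ} {l : List Bool} (hl : l ∈ words N) :
    typeCode N l = ((typeClass N l).card : ℝ)⁻¹ := by
  rw [typeCode, mem_words.1 hl, Nat.sub_self]
  rfl

theorem typeCode_nil_le {N : ℕ} (hN : 0 < N) :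
    typeCode N [] ≤ (N + 1) * Real.exp (3 * √N) := by
  have := sum_words_extensionSum (fun l => ((typeClass N l).card : ℝ)⁻¹) 0 N
  rw [words_zero, Finset.sum_singleton, zero_add] at this
  rw [typeCode, List.length_nil, Nat.sub_zero, this]
  exact sum_inv_card_typeClass_le hN

/-- The predictor that averages the conditional probabilities of the type code given the `t` most
recent symbols over `t = 0, …, n`. -/
def avgPredictor (n : ℕ) (l : List Bool) (b : Bool) : ℝ :=
  ∑ t ∈ Finset.range (n + 1), ((n : ℝ) + 1)⁻¹ *
    (typeCode (n + 1) (b :: l.take t) / typeCode (n + 1) (l.take t))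

theorem avgPredictor_nonneg (n : ℕ) (l : List Bool) (b : Bool) : 0 ≤ avgPredictor n l b :=
  Finset.sum_nonneg fun _ _ =>
    mul_nonneg (by positivity) (div_nonneg (typeCode_nonneg _ _) (typeCode_nonneg _ _))

theorem typeCode_take_div_pos {n t : ℕ} {l : List Bool} (hl : l ∈ words n) (b : Bool) :
    0 < typeCode (n + 1) (b :: l.take t) / typeCode (n + 1) (l.take t) := by
  rw [mem_words] at hl
  exact div_pos (typeCode_pos (by simp; omega)) (typeCode_pos (by simp; omega))

theorem avgPredictor_pos {n : ℕ} {l : List Bool} (hl : l ∈ words n) (b : Bool) :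
    0 < avgPredictor n l b :=
  Finset.sum_pos (fun _ _ => mul_pos (by positivity) (typeCode_take_div_pos hl b)) (by simp)

theorem avgPredictor_add {n : ℕ} {l : List Bool} (hl : l ∈ words n) :
    avgPredictor n l true + avgPredictor n l false = 1 := by
  rw [avgPredictor, avgPredictor, ← Finset.sum_add_distrib]
  rw [mem_words] at hl
  have : ∀ t ∈ Finset.range (n + 1), ((n : ℝ) + 1)⁻¹ *
      (typeCode (n + 1) (true :: l.take t) / typeCode (n + 1) (l.take t)) + ((n : ℝ) + 1)⁻¹ *
      (typeCode (n + 1) (false :: l.take t) / typeCode (n + 1) (l.take t)) =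
      ((n : ℝ) + 1)⁻¹ := by
    intro t _
    have hlt : (l.take t).length < n + 1 := by simp; omega
    rw [← mul_add, ← add_div, typeCode_cons_add hlt, div_self (typeCode_pos hlt.le).ne', mul_one]
  rw [Finset.sum_congr rfl this, Finset.sum_const, Finset.card_range, nsmul_eq_mul]
  push_cast
  exact mul_inv_cancel₀ (by positivity)

/-- Jensen: the log-loss of an average is at most the average of the log-losses. -/
theorem neg_log_avgPredictor_le {n : ℕ} {l : List Bool} (hl : l ∈ words n) (b : Bool) :
    -Real.log (avgPredictor n l b) ≤ ((n : ℝ) + 1)⁻¹ * ∑ t ∈ Finset.range (n + 1),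
      (Real.log (typeCode (n + 1) (l.take t)) -
        Real.log (typeCode (n + 1) (b :: l.take t))) := by
  have h := strictConcaveOn_log_Ioi.concaveOn.le_map_sum (t := Finset.range (n + 1))
    (w := fun _ => ((n : ℝ) + 1)⁻¹)
    (p := fun t => typeCode (n + 1) (b :: l.take t) / typeCode (n + 1) (l.take t))
    (fun _ _ => by positivity)
    (by
      rw [Finset.sum_const, Finset.card_range, nsmul_eq_mul]
      push_cast
      exact mul_inv_cancel₀ (by positivity))
    (fun t _ => typeCode_take_div_pos hl b)
  simp only [smul_eq_mul] at h
  rw [← Finset.mul_sum] at h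
  rw [avgPredictor, neg_le, ← mul_neg, ← Finset.sum_neg_distrib]
  refine le_trans (le_of_eq ?_) h
  congr 1
  refine Finset.sum_congr rfl fun t _ => ?_
  rw [mem_words] at hl
  rw [Real.log_div (typeCode_pos (by simp; omega)).ne' (typeCode_pos (by simp; omega)).ne']
  ring

section
variable {ν μ : PMF ℕ}

/-- Stationarity sums out the oldest symbols, so the last `m` of `m + k` symbols have the law of the
first `m`. -/
theorem sum_pathProb_mul_take
    (hst : ∀ l, pathProb ν μ (l ++ [true]) + pathProb ν μ (l ++ [false]) = pathProb ν μ l)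
    (F : List Bool → ℝ) (m k : ℕ) :
    ∑ l ∈ words (m + k), pathProb ν μ l * F (l.take m) = ∑ l ∈ words m, pathProb ν μ l * F l := by
  induction k with
  | zero =>
    refine Finset.sum_congr rfl fun l hl => ?_
    rw [← mem_words.1 hl, List.take_length]
  | succ k ih =>
    rw [← ih, ← add_assoc, sum_words_succ_last]
    refine Finset.sum_congr rfl fun l hl => ?_
    rw [mem_words] at hl
    rw [List.take_append_of_le_length (by omega), List.take_append_of_le_length (by omega),
      ← add_mul, hst]

/-- Summing the increments of a function along a word. -/
theorem sum_increments (hν : ν 0 = 0) (hμ : μ 0 = 0) (G : List Bool → ℝ) (n : ℕ) :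
    ∑ t ∈ Finset.range n, ∑ l ∈ words (t + 1), pathProb ν μ l * (G l.tail - G l) =
      G [] - ∑ l ∈ words n, pathProb ν μ l * G l := by
  induction n with
  | zero => simp [words_zero, pathProb_nil hν]
  | succ n ih =>
    rw [Finset.sum_range_succ, ih]
    simp only [mul_sub, Finset.sum_sub_distrib]
    have : ∑ l ∈ words (n + 1), pathProb ν μ l * G l.tail =
        ∑ l ∈ words n, pathProb ν μ l * G l := by
      rw [sum_words_succ]
      refine Finset.sum_congr rfl fun l _ => ?_
      rw [List.tail_cons, List.tail_cons, ← add_mul, pathProb_cons_add hμ]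
    rw [this]; ring

theorem likelihood_pos {l : List Bool} (h : 0 < pathProb ν μ l) : 0 < likelihood μ l :=
  h.trans_le (pathProb_le_likelihood l)

theorem pathProb_cons_le (hμ : μ 0 = 0) (b : Bool) (l : List Bool) :
    pathProb ν μ (b :: l) ≤ pathProb ν μ l := by
  have h1 := pathProb_nonneg (ν := ν) (μ := μ) (true :: l)
  have h2 := pathProb_nonneg (ν := ν) (μ := μ) (false :: l)
  rw [← pathProb_cons_add hμ l]
  cases b <;> linarith

theorem pathProb_le_pathProb_take
    (hst : ∀ l, pathProb ν μ (l ++ [true]) + pathProb ν μ (l ++ [false]) = pathProb ν μ l)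
    (l : List Bool) (t : ℕ) : pathProb ν μ l ≤ pathProb ν μ (l.take t) := by
  induction l using List.reverseRecOn with
  | nil => simp
  | append_singleton l b ih =>
    rcases Nat.lt_or_ge l.length t with h | h
    · rw [List.take_of_length_le (by simp; omega)]
    · rw [List.take_append_of_le_length h]
      refine le_trans ?_ ih
      have h1 := pathProb_nonneg (ν := ν) (μ := μ) (l ++ [true])
      have h2 := pathProb_nonneg (ν := ν) (μ := μ) (l ++ [false])
      rw [← hst l]
      cases b <;> linarith

/-- The log-loss of the likelihood at the most recent symbol. -/
def likelihoodLoss (μ : PMF ℕ) (l : List Bool) : ℝ :=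
  Real.log (likelihood μ l.tail) - Real.log (likelihood μ l)

theorem likelihood_cons_le (hμ : μ 0 = 0) (b : Bool) (l : List Bool) :
    likelihood μ (b :: l) ≤ likelihood μ l := by
  by_cases h : l.count true = 0
  · rw [likelihood_cons_of_count_eq_zero hμ h, likelihood_of_count_eq_zero h]
  · rw [likelihood_cons_of_count_pos hμ h, likelihood_eq_of_count_pos h]
    exact mul_le_mul_of_nonneg_left (stepMass_le _ _) (prod_gaps_nonneg l)

theorem likelihoodLoss_nonneg (hμ : μ 0 = 0) {l : List Bool} (h : 0 < pathProb ν μ l) :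
    0 ≤ likelihoodLoss μ l := by
  cases l with
  | nil => simp [likelihoodLoss]
  | cons b l =>
    exact sub_nonneg.2 (Real.log_le_log (likelihood_pos h) (likelihood_cons_le hμ b l))

theorem likelihoodLoss_of_count_eq_zero (hμ : μ 0 = 0) {l : List Bool} (b : Bool)
    (h : l.count true = 0) : likelihoodLoss μ (b :: l) = 0 := by
  rw [likelihoodLoss, List.tail_cons, likelihood_cons_of_count_eq_zero hμ h,
    likelihood_of_count_eq_zero h, sub_self]

theorem likelihoodLoss_of_count_pos (hμ : μ 0 = 0) {l : List Bool} {b : Bool}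
    (h : l.count true ≠ 0) (hp : 0 < pathProb ν μ (b :: l)) :
    likelihoodLoss μ (b :: l) =
      Real.log (tailProb μ (age l)) - Real.log (stepMass μ (age l) b) := by
  have h1 := likelihood_pos hp
  have h2 := h1.trans_le (likelihood_cons_le hμ b l)
  rw [likelihood_cons_of_count_pos hμ h] at h1
  rw [likelihood_eq_of_count_pos h] at h2
  rw [likelihoodLoss, List.tail_cons, likelihood_cons_of_count_pos hμ h,
    likelihood_eq_of_count_pos h, Real.log_mul (left_ne_zero_of_mul h2.ne')
      (right_ne_zero_of_mul h2.ne'), Real.log_mul (left_ne_zero_of_mul h1.ne')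
      (right_ne_zero_of_mul h1.ne')]
  ring

theorem age_take {l : List Bool} {t : ℕ} (h : (l.take t).count true ≠ 0) :
    age (l.take t) = age l := by
  induction l generalizing t with
  | nil => simp
  | cons b l ih =>
    cases t with
    | zero => simp at h
    | succ t =>
      cases b
      · simp only [List.take_succ_cons, age_false]
        rw [ih (by simpa using h)]
      · rfl

/-- If the truncated context still contains a one, the age is unchanged and the losses agree.
Otherwise the truncated loss is zero. -/
theorem likelihoodLoss_take_le (hμ : μ 0 = 0)
    (hst : ∀ l, pathProb ν μ (l ++ [true]) + pathProb ν μ (l ++ [false]) = pathProb ν μ l)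
    {l : List Bool} (h : 0 < pathProb ν μ l) (t : ℕ) :
    likelihoodLoss μ (l.take (t + 1)) ≤ likelihoodLoss μ l := by
  cases l with
  | nil => simp
  | cons b l =>
    have h1 := h.trans_le (pathProb_le_pathProb_take hst (b :: l) (t + 1))
    rw [List.take_succ_cons] at h1 ⊢
    by_cases h0 : (l.take t).count true = 0
    · rw [likelihoodLoss_of_count_eq_zero hμ b h0]
      exact likelihoodLoss_nonneg hμ h
    · have h2 : l.count true ≠ 0 := fun h3 => h0
        (Nat.le_zero.1 (h3 ▸ (List.take_sublist t l).count_le true))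
      rw [likelihoodLoss_of_count_pos hμ h0 h1, likelihoodLoss_of_count_pos hμ h2 h, age_take h0]

/-- Once a one has been seen there is equality. Before that the true conditional probability
involves the unknown `ν`, and it suffices that its logarithm is at most zero. -/
theorem pathProb_mul_log_le (hμ : μ 0 = 0) (b : Bool) (l : List Bool) :
    pathProb ν μ (b :: l) * Real.log (pathProb ν μ (b :: l) / pathProb ν μ l) ≤
      pathProb ν μ (b :: l) * -likelihoodLoss μ (b :: l) := by
  rcases (pathProb_nonneg (ν := ν) (μ := μ) (b :: l)).eq_or_lt with h | h
  · simp [← h]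
  · refine mul_le_mul_of_nonneg_left ?_ h.le
    have hl := h.trans_le (pathProb_cons_le hμ b l)
    by_cases h0 : l.count true = 0
    · rw [likelihoodLoss_of_count_eq_zero hμ b h0, neg_zero]
      exact Real.log_nonpos (by positivity) ((div_le_one hl).2 (pathProb_cons_le hμ b l))
    · rw [likelihoodLoss_of_count_pos hμ h0 h, neg_sub, Real.log_div h.ne' hl.ne']
      rw [pathProb_cons_of_count_pos hμ h0] at h ⊢
      rw [pathProb, waitLaw_pos _ _ (Nat.pos_of_ne_zero h0)] at hl ⊢
      rw [Real.log_mul (left_ne_zero_of_mul h.ne') (right_ne_zero_of_mul h.ne'),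
        Real.log_mul (left_ne_zero_of_mul hl.ne') (right_ne_zero_of_mul hl.ne')]
      linarith

theorem neg_log_typeCode_le (hμ : μ 0 = 0) {N : ℕ} {l : List Bool} (hl : l ∈ words N)
    (h : 0 < pathProb ν μ l) :
    -Real.log (typeCode N l) ≤ Real.log (N + 1) - Real.log (likelihood μ l) := by
  have h1 := likelihood_pos h
  have h2 : (0 : ℝ) < (typeClass N l).card := by exact_mod_cast typeClass_card_pos hl
  have h3 := Real.log_le_log (mul_pos h1 h2) (likelihood_mul_card_le hμ hl)
  rw [Real.log_mul h1.ne' h2.ne'] at h3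
  rw [typeCode_of_mem_words hl, Real.log_inv]
  linarith

/-- The log-loss regret of the averaged predictor against the true conditional law. -/
theorem sum_pathProb_mul_log_le (hν : ν 0 = 0) (hμ : μ 0 = 0)
    (hst : ∀ l, pathProb ν μ (l ++ [true]) + pathProb ν μ (l ++ [false]) = pathProb ν μ l)
    (n : ℕ) :
    ∑ l ∈ words n, ∑ b, pathProb ν μ (b :: l) *
        Real.log (pathProb ν μ (b :: l) / pathProb ν μ l / avgPredictor n l b) ≤
      ((n : ℝ) + 1)⁻¹ * (2 * Real.log (n + 2) + 3 * √(n + 1)) := by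
  set w := pathProb ν μ with hw
  have hN : (0 : ℝ) < (n : ℝ) + 1 := by positivity
  set E : ℕ → ℝ := fun t => ∑ l ∈ words (t + 1), w l * likelihoodLoss μ l with hE
  -- The expected loss with a short context is that of a truncated long context, hence at most the
  -- loss with full context.
  have hE_le : ∀ t ∈ Finset.range (n + 1), E t ≤ E n := by
    intro t ht
    rw [Finset.mem_range] at ht
    obtain ⟨k, rfl⟩ : ∃ k, n = t + k := ⟨n - t, by omega⟩
    simp only [hE]
    rw [← sum_pathProb_mul_take hst _ (t + 1) k, add_right_comm]
    refine Finset.sum_le_sum fun l _ => ?_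
    rcases (pathProb_nonneg (ν := ν) (μ := μ) l).eq_or_lt with h | h
    · simp [hw, ← h]
    · exact mul_le_mul_of_nonneg_left (likelihoodLoss_take_le hμ hst h t) h.le
  set Q := typeCode (n + 1) with hQ
  have hsumE : ∑ l ∈ words (n + 1), w l * -Real.log (likelihood μ l) ≤ (n + 1) * E n := by
    have h1 := sum_increments hν hμ (fun l => Real.log (likelihood μ l)) (n + 1)
    have h2 : Real.log (likelihood μ []) = 0 := by
      rw [likelihood_of_count_eq_zero (by simp), Real.log_one]
    rw [h2, zero_sub, ← Finset.sum_neg_distrib] at h1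
    simp only [mul_neg]
    rw [← h1]
    refine (Finset.sum_le_card_nsmul _ _ _ hE_le).trans_eq ?_
    rw [Finset.card_range, nsmul_eq_mul]; push_cast; rfl
  -- The code losses telescope to the loss on the whole word. One logarithm comes from the number of
  -- ages, the other from the total likelihood mass `n + 2`.
  have hcode : ∑ t ∈ Finset.range (n + 1), ∑ l ∈ words (t + 1),
      w l * (Real.log (Q l.tail) - Real.log (Q l)) ≤
      2 * Real.log (n + 2) + 3 * √(n + 1) + (n + 1) * E n := by
    rw [sum_increments hν hμ (fun l => Real.log (Q l))]
    have h1 : Real.log (Q []) ≤ Real.log (n + 2) + 3 * √(n + 1) := by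
      have h2 := Real.log_le_log (typeCode_pos (by simp)) (typeCode_nil_le (Nat.succ_pos n))
      rw [Real.log_mul (by positivity) (Real.exp_pos _).ne', Real.log_exp] at h2
      push_cast at h2
      rwa [show (n : ℝ) + 1 + 1 = n + 2 by ring] at h2
    have h2 : ∑ l ∈ words (n + 1), w l * -Real.log (Q l) ≤
        ∑ l ∈ words (n + 1), w l * (Real.log (n + 2) + -Real.log (likelihood μ l)) := by
      refine Finset.sum_le_sum fun l hl => ?_
      rcases (pathProb_nonneg (ν := ν) (μ := μ) l).eq_or_lt with h | h
      · simp [hw, ← h]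
      · refine mul_le_mul_of_nonneg_left ?_ h.le
        have h3 := neg_log_typeCode_le hμ hl h
        push_cast at h3
        rw [show (n : ℝ) + 1 + 1 = n + 2 by ring] at h3
        linarith
    simp only [mul_add, Finset.sum_add_distrib] at h2
    rw [← Finset.sum_mul, sum_pathProb hν hμ, one_mul] at h2
    simp only [mul_neg, Finset.sum_neg_distrib] at h2 hsumE
    linarith
  have hterm : ∀ l ∈ words n, ∑ b, w (b :: l) *
        Real.log (w (b :: l) / w l / avgPredictor n l b) ≤
      ∑ b, (w (b :: l) * -likelihoodLoss μ (b :: l) + ((n : ℝ) + 1)⁻¹ *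
        ∑ t ∈ Finset.range (n + 1), w (b :: l) *
          (Real.log (Q (l.take t)) - Real.log (Q (b :: l.take t)))) := by
    intro l hl
    refine Finset.sum_le_sum fun b _ => ?_
    rcases (pathProb_nonneg (ν := ν) (μ := μ) (b :: l)).eq_or_lt with h | h
    · simp [hw, ← h]
    · have h1 := pathProb_mul_log_le (ν := ν) hμ b l
      have h2 := mul_le_mul_of_nonneg_left (neg_log_avgPredictor_le hl b) h.le
      have hwl := h.trans_le (pathProb_cons_le hμ b l)
      rw [Real.log_div (div_pos h hwl).ne' (avgPredictor_pos hl b).ne', ← Finset.mul_sum]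
      rw [mul_left_comm] at h2
      rw [mul_sub]
      linarith
  refine (Finset.sum_le_sum hterm).trans ?_
  -- Stationarity moves each window of recent symbols to the start of the process. The term `-E n`
  -- then cancels the averaged entropy part of `hcode`, leaving only the redundancy.
  have hsplit : ∑ l ∈ words n, ∑ b, (w (b :: l) * -likelihoodLoss μ (b :: l) + ((n : ℝ) + 1)⁻¹ *
        ∑ t ∈ Finset.range (n + 1), w (b :: l) *
          (Real.log (Q (l.take t)) - Real.log (Q (b :: l.take t)))) =
      -E n + ((n : ℝ) + 1)⁻¹ * ∑ t ∈ Finset.range (n + 1), ∑ l ∈ words (t + 1),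
        w l * (Real.log (Q l.tail) - Real.log (Q l)) := by
    have h1 : ∀ F : List Bool → ℝ, ∑ l ∈ words n, ∑ b, F (b :: l) = ∑ l ∈ words (n + 1), F l := by
      intro F; rw [sum_words_succ]; simp
    have h2 := h1 fun l => w l * -likelihoodLoss μ l + ((n : ℝ) + 1)⁻¹ *
        ∑ t ∈ Finset.range (n + 1), w l *
          (Real.log (Q (l.take (t + 1)).tail) - Real.log (Q (l.take (t + 1))))
    simp only [List.take_succ_cons, List.tail_cons] at h2
    rw [h2, Finset.sum_add_distrib]
    simp only [mul_neg, Finset.sum_neg_distrib]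
    rw [← Finset.mul_sum, Finset.sum_comm]
    congr 2
    refine Finset.sum_congr rfl fun t ht => ?_
    rw [Finset.mem_range] at ht
    obtain ⟨k, hk⟩ : ∃ k, n + 1 = t + 1 + k := ⟨n - t, by omega⟩
    rw [hk]
    exact sum_pathProb_mul_take hst (fun l => Real.log (Q l.tail) - Real.log (Q l)) (t + 1) k
  rw [hsplit]
  have h3 := mul_le_mul_of_nonneg_left hcode (inv_nonneg.2 hN.le)
  have h4 : ((n : ℝ) + 1)⁻¹ * ((n + 1) * E n) = E n := by field_simp
  rw [mul_add, h4] at h3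
  linarith

end

/-! ### Upper bound on the minimax risk. -/

theorem renewalRisk_le_log (n : ℕ) :
    renewalRisk n ≤
      ENNReal.ofReal (((n : ℝ) + 1)⁻¹ * (2 * Real.log (n + 2) + 3 * √(n + 1))) := by
  have hm := isMarkovKernel_wordKernel (n := n) (avgPredictor_nonneg n) fun l hl =>
    avgPredictor_add hl
  refine (iInf₂_le (wordKernel n (avgPredictor n)) hm).trans ?_
  refine iSup₂_le fun P hP => ?_
  obtain ⟨ν, μ, hν, hμ, -, hst, hP⟩ := hP
  refine (predictionRiskAt_wordKernel_le (avgPredictor_nonneg n) (fun l hl => avgPredictor_pos hl)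
    (fun l hl => avgPredictor_add hl) P (hasWordLaw_of_eq_renewalLaw hν hμ hP)).trans ?_
  exact ENNReal.ofReal_le_ofReal (sum_pathProb_mul_log_le hν hμ
    (pathProb_append_of_isStationaryLaw hν hμ hst) n)

theorem renewalRisk_le {n : ℕ} (hn : 1 ≤ n) :
    renewalRisk n ≤ ENNReal.ofReal (11 * √((n : ℝ)⁻¹)) := by
  refine (renewalRisk_le_log n).trans (ENNReal.ofReal_le_ofReal ?_)
  have hn' : (0 : ℝ) < n := by exact_mod_cast hn
  set r := √((n : ℝ) + 1) with hr
  have hr0 : 0 < r := Real.sqrt_pos.2 (by positivity)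
  have hrr : r * r = n + 1 := Real.mul_self_sqrt (by positivity)
  -- This accounts for the constant: `2 * 4 + 3 = 11`.
  have h1 : Real.log ((n : ℝ) + 2) ≤ 4 * r := by
    have h2 : (n : ℝ) + 2 ≤ (2 * r) ^ 2 := by nlinarith
    have h3 := Real.log_le_log (by positivity) h2
    rw [Real.log_pow] at h3
    have h4 := Real.log_le_sub_one_of_pos (show 0 < 2 * r by positivity)
    push_cast at h3
    linarith
  have h5 : √((n : ℝ)⁻¹) ≥ r⁻¹ := by
    rw [hr, ← Real.sqrt_inv]
    exact Real.sqrt_le_sqrt (inv_anti₀ hn' (by linarith))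
  calc ((n : ℝ) + 1)⁻¹ * (2 * Real.log (n + 2) + 3 * r)
      ≤ ((n : ℝ) + 1)⁻¹ * (11 * r) := by gcongr; linarith
    _ = 11 * r⁻¹ := by rw [← hrr]; field_simp
    _ ≤ _ := by gcongr

end

/-! ### Sufficient condition for stationarity, and the rarity of given waits. -/

noncomputable section

section
variable {ν μ : PMF ℕ}

theorem prefixProb_of_count_eq_zero {l : List Bool} (h : l.count true = 0) :
    prefixProb ν μ l = 1 := by
  induction l with
  | nil => rfl
  | cons b l ih => cases b <;> simp_all [prefixProb]

theorem age_append_of_count_pos {l : List Bool} (h : l.count true ≠ 0) (l' : List Bool) :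
    age (l ++ l') = age l := by
  induction l with
  | nil => simp at h
  | cons b l ih => cases b <;> simp_all

theorem age_append_of_count_eq_zero {l : List Bool} (h : l.count true = 0) (l' : List Bool) :
    age (l ++ l') = l.length + age l' := by
  induction l with
  | nil => simp
  | cons b l ih => cases b <;> simp_all; omega

theorem prefixProb_append_of_count_eq_zero {l : List Bool} (h : l.count true = 0) :
    prefixProb ν μ (l ++ [true]) = (ν 1).toReal := by
  induction l with
  | nil => simp [prefixProb, waitLaw]
  | cons b l ih => cases b <;> simp_all [prefixProb]

/-- An older one turns the first wait into an interarrival wait, and an older zero lengthens it. The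
case at the first one is the identity `ν (t + 2) + ν 1 * μ (t + 1) = ν (t + 1)`, which holds when
`ν` is proportional to the tail of `μ`. -/
theorem prefixProb_append_of_count_pos
    (h : ∀ t, (ν (t + 1)).toReal = (ν 1).toReal * tailProb μ t)
    {l : List Bool} (hl : l.count true ≠ 0) :
    prefixProb ν μ (l ++ [true]) + prefixProb ν μ (l ++ [false]) = prefixProb ν μ l := by
  induction l with
  | nil => simp at hl
  | cons b l ih =>
    cases b
    · exact ih (by simpa using hl)
    · simp only [List.cons_append, prefixProb]
      by_cases h0 : l.count true = 0
      · rw [prefixProb_append_of_count_eq_zero h0, prefixProb_of_count_eq_zero h0,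
          prefixProb_of_count_eq_zero (by simpa using h0), age_append_of_count_eq_zero h0,
          age_append_of_count_eq_zero h0, age_eq_length h0, List.count_append, List.count_append, h0]
        simp only [List.count_singleton, age_true, age_false, age_nil, waitLaw]
        simp only [BEq.rfl, if_true, Nat.add_zero, Nat.zero_add]
        norm_num
        rw [h (l.length + 1), h l.length, tailProb_eq_add μ l.length]
        ring
      · rw [age_append_of_count_pos h0, age_append_of_count_pos h0, List.count_append,
          List.count_append, waitLaw_pos _ _ (by omega), waitLaw_pos _ _ (by omega),
          waitLaw_pos _ _ (by omega), ← add_mul, ih h0]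

theorem pathProb_append
    (h : ∀ t, (ν (t + 1)).toReal = (ν 1).toReal * tailProb μ t) (l : List Bool) :
    pathProb ν μ (l ++ [true]) + pathProb ν μ (l ++ [false]) = pathProb ν μ l := by
  by_cases h0 : l.count true = 0
  · rw [pathProb, pathProb, pathProb, prefixProb_append_of_count_eq_zero h0,
      prefixProb_of_count_eq_zero h0, prefixProb_of_count_eq_zero (by simpa using h0),
      age_append_of_count_eq_zero h0, age_append_of_count_eq_zero h0, age_eq_length h0,
      List.count_append, List.count_append, h0]
    simp only [List.count_singleton, age_true, age_false, age_nil, waitLaw]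
    simp only [BEq.rfl, if_true, Nat.add_zero, Nat.zero_add]
    norm_num
    rw [tailProb_eq_add ν l.length, h l.length]
  · rw [pathProb, pathProb, pathProb, age_append_of_count_pos h0, age_append_of_count_pos h0,
      List.count_append, List.count_append, waitLaw_pos _ _ (by omega),
      waitLaw_pos _ _ (by omega), waitLaw_pos _ _ (by omega), ← add_mul,
      prefixProb_append_of_count_pos h h0]

/-- The probability of the completed waits of a word, summed over the words with a given age. -/
theorem sum_prefixProb_of_age (hμ : μ 0 = 0)
    (h : ∀ t, (ν (t + 1)).toReal = (ν 1).toReal * tailProb μ t) (s a : ℕ) (ha : a < s) :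
    ∑ l ∈ words s, (if l.count true ≠ 0 ∧ age l = a then prefixProb ν μ l else 0) =
      (ν 1).toReal := by
  induction s generalizing a with
  | zero => omega
  | succ s ih =>
    rw [sum_words_succ]
    cases a with
    | zero =>
      -- The sum is the probability of a one at the latest time, which by stationarity is that of a
      -- one at time `1`.
      have h1 := sum_pathProb_mul_take (pathProb_append h)
        (fun l => if l.head? = some true then 1 else 0) 1 s
      rw [add_comm 1 s, sum_words_succ, sum_words_succ 0, words_zero, Finset.sum_singleton] at h1
      simp only [List.take_succ_cons, List.head?_cons, if_true, mul_one] at h1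
      simp only [pathProb_cons_true hμ] at h1
      simp [prefixProb, waitLaw_zero] at h1 ⊢
      exact h1
    | succ a =>
      rw [← ih a (by omega)]
      refine Finset.sum_congr rfl fun l _ => ?_
      simp [prefixProb]

/-- A word in which one of the waits `x` and `y` occurs between two ones. -/
def HasGap (x y : ℕ) (l : List Bool) : Prop := x ∈ gaps l ∨ y ∈ gaps l

instance (x y : ℕ) : DecidablePred (HasGap x y) := fun l =>
  inferInstanceAs (Decidable (x ∈ gaps l ∨ y ∈ gaps l))

theorem hasGap_cons_false {x y : ℕ} {l : List Bool} :
    HasGap x y (false :: l) ↔ HasGap x y l := Iff.rfl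

/-- Words in which one of two rare waits occurs have small probability. -/
theorem sum_prefixProb_of_hasGap_le (hμ : μ 0 = 0)
    (h : ∀ t, (ν (t + 1)).toReal = (ν 1).toReal * tailProb μ t) {L x y : ℕ} {κ : ℝ} (hκ : 0 ≤ κ)
    (hL : ∀ t < L, μ t = 0) (hxy : (μ x).toReal + (μ y).toReal ≤ κ * L) (s a : ℕ) (ha : a < s) :
    ∑ l ∈ words s, (if l.count true ≠ 0 ∧ age l = a ∧ HasGap x y l then prefixProb ν μ l else 0) ≤
      (ν 1).toReal * κ * (s - a) := by
  have hp0 : 0 ≤ (ν 1).toReal := ENNReal.toReal_nonneg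
  induction s generalizing a with
  | zero => omega
  | succ s ih =>
    rw [sum_words_succ]
    cases a with
    | succ a =>
      have := ih a (by omega)
      push_cast
      rw [add_sub_add_right_eq_sub]
      refine le_trans (le_of_eq ?_) this
      refine Finset.sum_congr rfl fun l _ => ?_
      simp [prefixProb, hasGap_cons_false]
    | zero =>
      set m : ℕ → ℝ := fun t => (μ t).toReal with hm
      have hm0 : ∀ t, 0 ≤ m t := fun t => ENNReal.toReal_nonneg
      have hmL : ∀ t < L, m t = 0 := fun t ht => by simp [hm, hL t ht]
      have part : ∀ (p : List Bool → Prop) [DecidablePred p], ∀ c : ℕ → ℝ,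
          ∑ l ∈ words s, (if l.count true ≠ 0 ∧ p l then prefixProb ν μ l * c (age l) else 0) =
          ∑ b ∈ Finset.range s, c b * ∑ l ∈ words s,
            (if l.count true ≠ 0 ∧ age l = b ∧ p l then prefixProb ν μ l else 0) := by
        intro p _ c
        simp only [Finset.mul_sum]
        rw [Finset.sum_comm]
        refine Finset.sum_congr rfl fun l hl => ?_
        by_cases h0 : l.count true ≠ 0 ∧ p l
        · have h1 := age_lt_length (Nat.pos_of_ne_zero h0.1)
          rw [mem_words.1 hl] at h1
          rw [if_pos h0, Finset.sum_eq_single_of_mem (age l) (Finset.mem_range.2 h1),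
            if_pos ⟨h0.1, rfl, h0.2⟩, mul_comm]
          intro b _ hb
          rw [if_neg fun h => hb h.2.1.symm, mul_zero]
        · rw [if_neg h0, Finset.sum_eq_zero]
          intro b _
          rw [if_neg fun h => h0 ⟨h.1, h.2.2⟩, mul_zero]
      have step : ∀ l ∈ words s,
          ((if (true :: l).count true ≠ 0 ∧ age (true :: l) = 0 ∧ HasGap x y (true :: l)
              then prefixProb ν μ (true :: l) else 0) +
            if (false :: l).count true ≠ 0 ∧ age (false :: l) = 0 ∧ HasGap x y (false :: l)
              then prefixProb ν μ (false :: l) else 0) ≤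
          (if l.count true ≠ 0 ∧ HasGap x y l then prefixProb ν μ l * m (age l + 1) else 0) +
          (if l.count true ≠ 0 ∧ True then prefixProb ν μ l *
            ((if age l + 1 = x then m x else 0) + (if age l + 1 = y then m y else 0)) else 0) := by
        intro l _
        have hpr := prefixProb_nonneg (ν := ν) (μ := μ) l
        rw [if_neg (show ¬((false :: l).count true ≠ 0 ∧ age (false :: l) = 0 ∧
          HasGap x y (false :: l)) by simp), add_zero]
        by_cases h0 : l.count true = 0
        · have : ¬ HasGap x y (true :: l) := by simp [HasGap, gaps, h0, gaps_eq_zero h0]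
          simp [this, h0]
        · simp only [prefixProb, waitLaw_pos ν μ (Nat.pos_of_ne_zero h0)]
          have e1 : 0 ≤ m (age l + 1) := hm0 _
          have hx := hm0 x
          have hy := hm0 y
          by_cases hg : HasGap x y l
          · have : HasGap x y (true :: l) := by
              rcases hg with hg | hg <;> simp [HasGap, gaps, h0, hg]
            simp only [this, hg, h0, ne_eq, not_false_eq_true, age_true, and_true, if_true]
            rw [if_pos (by simp)]
            refine le_add_of_nonneg_right (mul_nonneg hpr ?_)
            split_ifs <;> linarith
          · simp only [hg, h0, ne_eq, not_false_eq_true, true_and, and_false, if_false, if_true,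
              zero_add]
            by_cases hg' : HasGap x y (true :: l)
            · have h2 : age l + 1 = x ∨ age l + 1 = y := by
                simp only [HasGap, gaps, h0, if_false, Multiset.mem_cons] at hg' hg
                push Not at hg
                rcases hg' with (h | h) | (h | h)
                · exact Or.inl h.symm
                · exact absurd h hg.1
                · exact Or.inr h.symm
                · exact absurd h hg.2
              rw [if_pos ⟨by simp, rfl, hg'⟩]
              refine mul_le_mul_of_nonneg_left ?_ hpr
              change m (age l + 1) ≤ _
              rcases h2 with h2 | h2
              · rw [h2, if_pos rfl]
                refine le_add_of_nonneg_right ?_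
                split_ifs <;> linarith
              · rw [h2, if_pos rfl]
                refine le_add_of_nonneg_left ?_
                split_ifs with h3
                · linarith
                · exact le_rfl
            · rw [if_neg fun h => hg' h.2.2]
              refine mul_nonneg hpr ?_
              split_ifs <;> linarith
      refine (Finset.sum_le_sum step).trans ?_
      rw [Finset.sum_add_distrib, part _ fun a => m (a + 1), part (fun _ => True)
        fun a => (if a + 1 = x then m x else 0) + (if a + 1 = y then m y else 0)]
      set p := (ν 1).toReal with hp
      have hfirst : ∀ b ∈ Finset.range s, m (b + 1) * ∑ l ∈ words s,
            (if l.count true ≠ 0 ∧ age l = b ∧ HasGap x y l then prefixProb ν μ l else 0) ≤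
          m (b + 1) * (p * κ * (s + 1 - L)) := by
        intro b hb
        rcases Nat.lt_or_ge (b + 1) L with hbL | hbL
        · simp [hmL _ hbL]
        · refine mul_le_mul_of_nonneg_left ((ih b (Finset.mem_range.1 hb)).trans ?_) (hm0 _)
          refine mul_le_mul_of_nonneg_left ?_ (mul_nonneg hp0 hκ)
          have : (L : ℝ) ≤ b + 1 := by exact_mod_cast hbL
          linarith
      have hsecond : ∀ b ∈ Finset.range s,
          ((if b + 1 = x then m x else 0) + (if b + 1 = y then m y else 0)) * ∑ l ∈ words s,
            (if l.count true ≠ 0 ∧ age l = b ∧ True then prefixProb ν μ l else 0) =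
          ((if b + 1 = x then m x else 0) + (if b + 1 = y then m y else 0)) * p := by
        intro b hb
        have := sum_prefixProb_of_age hμ h s b (Finset.mem_range.1 hb)
        simp only [and_true]
        rw [this]
      refine (add_le_add (Finset.sum_le_sum hfirst) (Finset.sum_congr rfl hsecond).le).trans ?_
      rw [← Finset.sum_mul, ← Finset.sum_mul, Finset.sum_add_distrib]
      have hone : ∀ z, ∑ b ∈ Finset.range s, (if b + 1 = z then m z else 0) ≤ m z := by
        intro z
        rw [← Finset.sum_filter, Finset.sum_const]
        have : ((Finset.range s).filter fun b => b + 1 = z).card ≤ 1 :=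
          Finset.card_le_one.2 fun a ha b hb => by
            rw [Finset.mem_filter] at ha hb; omega
        calc _ ≤ 1 • m z := nsmul_le_nsmul_left (hm0 z) this
          _ = m z := one_smul _ _
      have hzero : ∀ z ≤ s, s < L → m z = 0 := fun z hz hsL => hmL z (by omega)
      rcases Nat.lt_or_ge s L with hsL | hsL
      · have e1 : ∑ b ∈ Finset.range s, m (b + 1) = 0 := Finset.sum_eq_zero fun b hb =>
          hzero _ (by rw [Finset.mem_range] at hb; omega) hsL
        have e2 : ∀ z, ∑ b ∈ Finset.range s, (if b + 1 = z then m z else 0) = 0 := fun z =>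
          Finset.sum_eq_zero fun b hb => by
            split_ifs with h
            · exact hzero z (by rw [Finset.mem_range] at hb; omega) hsL
            · rfl
        rw [e1, e2, e2]
        simp only [zero_mul, add_zero]
        exact mul_nonneg (mul_nonneg hp0 hκ) (by simp; positivity)
      · have hsL' : (L : ℝ) ≤ s := by exact_mod_cast hsL
        have e1 : ∑ b ∈ Finset.range s, m (b + 1) ≤ 1 := by
          have := tailProb_nonneg μ s
          rw [tailProb, Finset.sum_range_succ'] at this
          have h0 := hm0 0
          simp only [hm] at h0 ⊢
          linarith
        have e2 := hone x
        have e3 := hone y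
        have e4 : 0 ≤ p * κ * ((s : ℝ) + 1 - L) :=
          mul_nonneg (mul_nonneg hp0 hκ) (by linarith)
        have e5 := mul_le_mul_of_nonneg_right e1 e4
        have e6 := mul_le_mul_of_nonneg_right ((add_le_add e2 e3).trans hxy) hp0
        push_cast
        nlinarith

end
end

/-! ### The family of perturbed interarrival laws. -/

noncomputable section

/-- The probability law on `ℕ` with a given finitely supported density. -/
def finitePMF (f : ℕ → ℝ) (N : ℕ) (h0 : ∀ t, 0 ≤ f t) (h1 : ∑ t ∈ Finset.range N, f t = 1)
    (hN : ∀ t, N ≤ t → f t = 0) : PMF ℕ :=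
  PMF.ofFinset (fun t => ENNReal.ofReal (f t)) (Finset.range N)
    (by rw [← ENNReal.ofReal_sum_of_nonneg fun t _ => h0 t, h1, ENNReal.ofReal_one])
    fun t ht => by rw [hN t (by simpa using ht), ENNReal.ofReal_zero]

theorem finitePMF_toReal {f : ℕ → ℝ} {N : ℕ} (h0 : ∀ t, 0 ≤ f t)
    (h1 : ∑ t ∈ Finset.range N, f t = 1) (hN : ∀ t, N ≤ t → f t = 0) (t : ℕ) :
    (finitePMF f N h0 h1 hN t).toReal = f t := by
  rw [finitePMF, PMF.ofFinset_apply, ENNReal.toReal_ofReal (h0 t)]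

theorem tailProb_antitone (μ : PMF ℕ) : Antitone (tailProb μ) :=
  antitone_nat_of_succ_le fun a => by
    rw [tailProb_eq_add μ a]
    exact le_add_of_nonneg_left ENNReal.toReal_nonneg

/-- A bounded interarrival law has a stationary initial law. -/
theorem exists_stationary_initial {μ : PMF ℕ} (hμ : μ 0 = 0) {B : ℕ} (hB : tailProb μ B = 0) :
    ∃ ν : PMF ℕ, ν 0 = 0 ∧ ∀ t, (ν (t + 1)).toReal =
      tailProb μ t / ∑ s ∈ Finset.range (B + 1), tailProb μ s := by
  set D := ∑ s ∈ Finset.range (B + 1), tailProb μ s with hD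
  have hD0 : 0 < D := by
    refine Finset.sum_pos' (fun t _ => tailProb_nonneg μ t) ⟨0, by simp, ?_⟩
    rw [tailProb_zero hμ]; exact one_pos
  set f : ℕ → ℝ := fun t => if t = 0 then 0 else tailProb μ (t - 1) / D with hf
  have h0 : ∀ t, 0 ≤ f t := fun t => by
    simp only [hf]; split_ifs
    · exact le_rfl
    · exact div_nonneg (tailProb_nonneg _ _) hD0.le
  have h1 : ∑ t ∈ Finset.range (B + 2), f t = 1 := by
    rw [Finset.sum_range_succ']
    simp only [hf, Nat.add_sub_cancel, Nat.succ_ne_zero, if_false, if_true, add_zero]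
    rw [← Finset.sum_div, ← hD, div_self hD0.ne']
  have h2 : ∀ t, B + 2 ≤ t → f t = 0 := fun t ht => by
    have h3 : tailProb μ (t - 1) = 0 :=
      le_antisymm ((tailProb_antitone μ (show B ≤ t - 1 by omega)).trans_eq hB)
        (tailProb_nonneg _ _)
    simp only [hf, h3, zero_div, ite_self]
  refine ⟨finitePMF f (B + 2) h0 h1 h2, ?_, fun t => ?_⟩
  · simp [finitePMF, hf]
  · rw [finitePMF_toReal]; simp [hf]

/-- The density with mass `1 / M` on each pair `{L + 2 i, L + 2 i + 1}`, `i < M`, of which the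
first point has the larger share if and only if `i ∈ T`. -/
def pairMass (L M : ℕ) (T : Finset ℕ) (t : ℕ) : ℝ :=
  if L ≤ t ∧ t < L + 2 * M then
    (M : ℝ)⁻¹ * if ((t - L) / 2 ∈ T ↔ (t - L) % 2 = 0) then 4 / 5 else 1 / 5
  else 0

section
variable {L M : ℕ} {T : Finset ℕ}

theorem pairMass_nonneg (t : ℕ) : 0 ≤ pairMass L M T t := by
  rw [pairMass]; split_ifs <;> positivity

theorem pairMass_even {i : ℕ} (hi : i < M) :
    pairMass L M T (L + 2 * i) = (M : ℝ)⁻¹ * if i ∈ T then 4 / 5 else 1 / 5 := by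
  rw [pairMass, if_pos (by omega), show (L + 2 * i - L) / 2 = i by omega,
    show (L + 2 * i - L) % 2 = 0 by omega]
  simp

theorem pairMass_odd {i : ℕ} (hi : i < M) :
    pairMass L M T (L + 2 * i + 1) = (M : ℝ)⁻¹ * if i ∈ T then 1 / 5 else 4 / 5 := by
  rw [pairMass, if_pos (by omega), show (L + 2 * i + 1 - L) / 2 = i by omega,
    show (L + 2 * i + 1 - L) % 2 = 1 by omega]
  by_cases h : i ∈ T <;> simp [h]

theorem pairMass_of_lt {t : ℕ} (ht : t < L) : pairMass L M T t = 0 := if_neg (by omega)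

theorem pairMass_of_ge {t : ℕ} (ht : L + 2 * M ≤ t) : pairMass L M T t = 0 := if_neg (by omega)

theorem sum_pairMass {i : ℕ} (hi : i ≤ M) :
    ∑ t ∈ Finset.range (L + 2 * i), pairMass L M T t = i * (M : ℝ)⁻¹ := by
  induction i with
  | zero =>
    rw [Finset.sum_eq_zero fun t ht => pairMass_of_lt (by simpa using ht)]
    simp
  | succ i ih =>
    rw [show L + 2 * (i + 1) = L + 2 * i + 1 + 1 by ring, Finset.sum_range_succ,
      Finset.sum_range_succ, ih (by omega), pairMass_even (by omega), pairMass_odd (by omega)]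
    split_ifs <;> push_cast <;> ring

theorem sum_pairMass_add (hM : 0 < M) (k : ℕ) :
    ∑ t ∈ Finset.range (L + 2 * M + k), pairMass L M T t = 1 := by
  rw [Finset.sum_range_add, sum_pairMass le_rfl,
    Finset.sum_eq_zero fun t _ => pairMass_of_ge (by omega), add_zero]
  exact mul_inv_cancel₀ (by exact_mod_cast hM.ne')

theorem pairMass_symmDiff_of_ne {i t : ℕ} (h1 : t ≠ L + 2 * i) (h2 : t ≠ L + 2 * i + 1) :
    pairMass L M (symmDiff T {i}) t = pairMass L M T t := by
  rw [pairMass, pairMass]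
  split_ifs with h h3 h4 h4
  · rfl
  all_goals first
    | rfl
    | (exfalso
       have h5 : (t - L) / 2 ≠ i := by omega
       simp [Finset.mem_symmDiff, h5] at h3
       tauto)

/-- The shares `4 / 5` and `1 / 5` differ by a factor four. -/
theorem pairMass_le (T' : Finset ℕ) (t : ℕ) : pairMass L M T t ≤ 4 * pairMass L M T' t := by
  have : (0 : ℝ) ≤ (M : ℝ)⁻¹ := by positivity
  rw [pairMass, pairMass]
  split_ifs <;> nlinarith

end

/-- The law with density `pairMass`. -/
def pairPMF (L M : ℕ) (hM : 0 < M) (T : Finset ℕ) : PMF ℕ :=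
  finitePMF (pairMass L M T) (L + 2 * M) pairMass_nonneg (sum_pairMass_add hM 0)
    fun _ => pairMass_of_ge

section
variable {L M : ℕ} {hM : 0 < M} {T : Finset ℕ}

theorem pairPMF_toReal (t : ℕ) : (pairPMF L M hM T t).toReal = pairMass L M T t :=
  finitePMF_toReal _ _ _ t

theorem pairPMF_of_lt {t : ℕ} (ht : t < L) : pairPMF L M hM T t = 0 := by
  have h := pairPMF_toReal (L := L) (M := M) (hM := hM) (T := T) t
  rw [pairMass_of_lt ht, ENNReal.toReal_eq_zero_iff] at h
  exact h.resolve_right (PMF.apply_ne_top _ _)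

theorem pairPMF_of_ge {t : ℕ} (ht : L + 2 * M ≤ t) : pairPMF L M hM T t = 0 := by
  have h := pairPMF_toReal (L := L) (M := M) (hM := hM) (T := T) t
  rw [pairMass_of_ge ht, ENNReal.toReal_eq_zero_iff] at h
  exact h.resolve_right (PMF.apply_ne_top _ _)

theorem tailProb_pairPMF (a : ℕ) :
    tailProb (pairPMF L M hM T) a = 1 - ∑ t ∈ Finset.range (a + 1), pairMass L M T t := by
  simp only [tailProb, pairPMF_toReal]

theorem tailProb_pairPMF_of_add_one_eq {a i : ℕ} (hi : i ≤ M) (ha : a + 1 = L + 2 * i) :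
    tailProb (pairPMF L M hM T) a = 1 - i * (M : ℝ)⁻¹ := by
  rw [tailProb_pairPMF, ha, sum_pairMass hi]

theorem tailProb_pairPMF_of_lt {a : ℕ} (ha : a < L) : tailProb (pairPMF L M hM T) a = 1 := by
  rw [tailProb_pairPMF, Finset.sum_eq_zero fun t ht => pairMass_of_lt
    (by rw [Finset.mem_range] at ht; omega), sub_zero]

theorem tailProb_pairPMF_le (T' : Finset ℕ) (a : ℕ) :
    tailProb (pairPMF L M hM T) a ≤ 4 * tailProb (pairPMF L M hM T') a := by
  -- Writing the tail as a sum of masses lets the pointwise comparison pass to it. The upper end is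
  -- padded by `a + 1` to keep the interval ordered for every `a`.
  have h : ∀ T, tailProb (pairPMF L M hM T) a =
      ∑ t ∈ Finset.Ico (a + 1) (L + 2 * M + (a + 1)), pairMass L M T t := by
    intro T
    rw [tailProb_pairPMF, ← sum_pairMass_add (L := L) (T := T) hM (a + 1),
      Finset.sum_Ico_eq_sub _ (by omega)]
  rw [h, h, Finset.mul_sum]
  exact Finset.sum_le_sum fun t _ => pairMass_le T' t

theorem sum_tailProb_pairPMF_le :
    ∑ s ∈ Finset.range (L + 2 * M), tailProb (pairPMF L M hM T) s ≤ L + 2 * M := by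
  refine (Finset.sum_le_card_nsmul _ _ 1 fun s _ => tailProb_le_one _ s).trans_eq ?_
  simp

theorem le_sum_tailProb_pairPMF :
    (L : ℝ) ≤ ∑ s ∈ Finset.range (L + 2 * M), tailProb (pairPMF L M hM T) s := by
  rw [Finset.sum_range_add]
  refine le_trans (le_of_eq ?_) (le_add_of_nonneg_right
    (Finset.sum_nonneg fun _ _ => tailProb_nonneg _ _))
  rw [Finset.sum_congr rfl fun s hs => tailProb_pairPMF_of_lt (Finset.mem_range.1 hs)]
  simp

theorem tsum_mul_pairPMF_lt_top : ∑' t : ℕ, (t : ℝ≥0∞) * pairPMF L M hM T t < ∞ := by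
  rw [tsum_eq_sum (s := Finset.range (L + 2 * M)) fun t ht => by
    rw [pairPMF_of_ge (by simpa using ht), mul_zero]]
  exact ENNReal.sum_lt_top.2 fun t _ =>
    ENNReal.mul_lt_top (ENNReal.natCast_lt_top t) (PMF.apply_lt_top _ _)

end

/-- The first wait costs the factor `c`. Every later wait avoids `x` and `y`, where alone the two
interarrival laws may differ. -/
theorem mul_prefixProb_le {ν μ ν' μ' : PMF ℕ} {c : ℝ} (hc : c ≤ 1) {x y : ℕ}
    (hν : ∀ t, c * (ν t).toReal ≤ (ν' t).toReal) (hμ : ∀ t, t ≠ x → t ≠ y → μ' t = μ t)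
    {l : List Bool} (hl : ¬ HasGap x y l) : c * prefixProb ν μ l ≤ prefixProb ν' μ' l := by
  induction l with
  | nil => simpa [prefixProb] using hc
  | cons b l ih =>
    cases b
    · exact ih hl
    · simp only [prefixProb]
      by_cases h0 : l.count true = 0
      · rw [h0, prefixProb_of_count_eq_zero h0, prefixProb_of_count_eq_zero h0, one_mul, one_mul]
        exact hν _
      · simp only [HasGap, gaps, h0, if_false, Multiset.mem_cons, not_or] at hl
        rw [waitLaw_pos _ _ (Nat.pos_of_ne_zero h0), waitLaw_pos _ _ (Nat.pos_of_ne_zero h0),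
          ← mul_assoc, hμ _ (fun h => hl.1.1 h.symm) (fun h => hl.2.1 h.symm)]
        exact mul_le_mul_of_nonneg_right (ih fun h => h.elim hl.1.2 hl.2.2)
          ENNReal.toReal_nonneg

/-! ### Hellinger risk by age, the comparison of two models, and the lower bound. -/

/-- The contribution of the words of age `a` to the Hellinger risk of the predictor whose square
root is `q`. -/
def ageLoss (ν μ : PMF ℕ) (n a : ℕ) (q : List Bool → ℝ) : ℝ :=
  ∑ l ∈ words n, if l.count true ≠ 0 ∧ age l = a then
    pathProb ν μ l * (√((μ (a + 1)).toReal / tailProb μ a) - q l) ^ 2 else 0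

section
variable {ν μ : PMF ℕ}

theorem pathProb_mul_sq_eq (hμ : μ 0 = 0) {l : List Bool} (h : l.count true ≠ 0) (q : ℝ) :
    pathProb ν μ l * (√(pathProb ν μ (true :: l) / pathProb ν μ l) - q) ^ 2 =
      pathProb ν μ l * (√((μ (age l + 1)).toReal / tailProb μ (age l)) - q) ^ 2 := by
  rcases eq_or_ne (pathProb ν μ l) 0 with h0 | h0
  · rw [h0, zero_mul, zero_mul]
  · have h1 := h0
    rw [pathProb] at h1
    rw [pathProb_cons_true hμ, pathProb, waitLaw_pos _ _ (Nat.pos_of_ne_zero h),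
      mul_div_mul_left _ _ (left_ne_zero_of_mul h1)]

/-- A word has only one age, so losses at distinct ages come from disjoint sets of words. -/
theorem sum_ageLoss_le (hμ : μ 0 = 0) (n : ℕ) (q : List Bool → ℝ) {ι : Type*} (s : Finset ι)
    {a : ι → ℕ} (ha : Function.Injective a) :
    ∑ i ∈ s, ageLoss ν μ n (a i) q ≤ ∑ l ∈ words n, pathProb ν μ l *
      (√(pathProb ν μ (true :: l) / pathProb ν μ l) - q l) ^ 2 := by
  simp only [ageLoss]
  rw [Finset.sum_comm]
  refine Finset.sum_le_sum fun l _ => ?_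
  have hpos : 0 ≤ pathProb ν μ l * (√(pathProb ν μ (true :: l) / pathProb ν μ l) - q l) ^ 2 :=
    mul_nonneg (pathProb_nonneg l) (sq_nonneg _)
  by_cases h : ∃ i ∈ s, l.count true ≠ 0 ∧ age l = a i
  · obtain ⟨i, hi, h1, h2⟩ := h
    rw [Finset.sum_eq_single_of_mem i hi, if_pos ⟨h1, h2⟩, pathProb_mul_sq_eq hμ h1, h2]
    intro j _ hj
    rw [if_neg fun h => hj (ha (h.2.symm.trans h2))]
  · rw [Finset.sum_eq_zero]
    · exact hpos
    · intro i hi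
      rw [if_neg fun h' => h ⟨i, hi, h'⟩]

theorem ageLoss_le_predictionRiskAt (hν : ν 0 = 0) (hμ : μ 0 = 0) {n : ℕ}
    (Q : Kernel (Fin n → Bool) Bool) [IsMarkovKernel Q]
    (P : ProbabilityMeasure (Fin (n + 1) → Bool))
    (hP : (P : Measure (Fin (n + 1) → Bool)) =
      (renewalLaw ν μ).map (fun (x : ℕ → Bool) (i : Fin (n + 1)) => x i))
    {ι : Type*} (s : Finset ι) {a : ι → ℕ} (ha : Function.Injective a) :
    ENNReal.ofReal (∑ i ∈ s, ageLoss ν μ n (a i)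
      fun l => √((Q fun j => l.reverse.getD j true).real {true})) ≤ predictionRiskAt Q P := by
  refine le_trans ?_ (sum_le_predictionRiskAt Q P (hasWordLaw_of_eq_renewalLaw hν hμ hP))
  rw [← ENNReal.ofReal_sum_of_nonneg fun _ _ => mul_nonneg (pathProb_nonneg _) (sq_nonneg _)]
  refine ENNReal.ofReal_le_ofReal ((sum_ageLoss_le hμ n _ s ha).trans_eq ?_)
  rw [sum_words_eq_sum_fin]
  refine Finset.sum_congr rfl fun y _ => ?_
  -- The default `true` is never reached, since the word has length `n`.
  have : (fun j : Fin n => (List.ofFn y).reverse.reverse.getD j true) = y := by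
    funext j
    rw [List.reverse_reverse, List.getD_eq_getElem _ _ (by simp)]
    simp
  rw [this]

theorem le_sum_pathProb_not_hasGap (hμ : μ 0 = 0)
    (h : ∀ t, (ν (t + 1)).toReal = (ν 1).toReal * tailProb μ t) {L x y : ℕ} {κ : ℝ} (hκ : 0 ≤ κ)
    (hL : ∀ t < L, μ t = 0) (hxy : (μ x).toReal + (μ y).toReal ≤ κ * L) {n a : ℕ} (ha : a < n) :
    tailProb μ a * ((ν 1).toReal * (1 - κ * n)) ≤
      ∑ l ∈ words n, (if l.count true ≠ 0 ∧ age l = a ∧ ¬ HasGap x y l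
        then pathProb ν μ l else 0) := by
  have h1 := sum_prefixProb_of_age hμ h n a ha
  have h2 := sum_prefixProb_of_hasGap_le hμ h hκ hL hxy n a ha
  have h3 : ∑ l ∈ words n, (if l.count true ≠ 0 ∧ age l = a ∧ ¬ HasGap x y l
        then pathProb ν μ l else 0) = tailProb μ a *
      (∑ l ∈ words n, (if l.count true ≠ 0 ∧ age l = a then prefixProb ν μ l else 0) -
      ∑ l ∈ words n, (if l.count true ≠ 0 ∧ age l = a ∧ HasGap x y l
        then prefixProb ν μ l else 0)) := by
    rw [← Finset.sum_sub_distrib, Finset.mul_sum]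
    refine Finset.sum_congr rfl fun l _ => ?_
    by_cases h0 : l.count true ≠ 0 ∧ age l = a
    · by_cases hg : HasGap x y l
      · simp [h0, hg]
      · rw [if_pos ⟨h0.1, h0.2, hg⟩, if_pos h0, if_neg fun h => hg h.2.2, sub_zero, pathProb,
          waitLaw_pos _ _ (Nat.pos_of_ne_zero h0.1), h0.2, mul_comm]
    · rw [if_neg fun h => h0 ⟨h.1, h.2.1⟩, if_neg h0, if_neg fun h => h0 ⟨h.1, h.2.1⟩]
      simp
  rw [h3, h1]
  refine mul_le_mul_of_nonneg_left ?_ (tailProb_nonneg _ _)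
  have h4 : (ν 1).toReal * κ * ((n : ℝ) - a) ≤ (ν 1).toReal * κ * n :=
    mul_le_mul_of_nonneg_left (by simp) (mul_nonneg ENNReal.toReal_nonneg hκ)
  linarith

end

/-- Both weights are at least `c * W`, and `(u - q) ^ 2 + (v - q) ^ 2 ≥ (u - v) ^ 2 / 2`. -/
theorem mul_sq_add_mul_sq_ge {W W' c u v q : ℝ} (hW : 0 ≤ W) (hc0 : 0 ≤ c) (hc : c ≤ 1)
    (h : c * W ≤ W') :
    c * W * ((u - v) ^ 2 / 2) ≤ W * (u - q) ^ 2 + W' * (v - q) ^ 2 := by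
  have h1 : c * W * (v - q) ^ 2 ≤ W' * (v - q) ^ 2 := mul_le_mul_of_nonneg_right h (sq_nonneg _)
  have h2 : c * W * (u - q) ^ 2 ≤ W * (u - q) ^ 2 :=
    mul_le_mul_of_nonneg_right (by nlinarith) (sq_nonneg _)
  have h3 : c * W * ((u - v) ^ 2 / 2) ≤ c * W * ((u - q) ^ 2 + (v - q) ^ 2) :=
    mul_le_mul_of_nonneg_left (by nlinarith [sq_nonneg (u + v - 2 * q)]) (by positivity)
  nlinarith

theorem sq_sqrt_four_mul_sub {u : ℝ} (hu : 0 ≤ u) : (√(4 * u) - √u) ^ 2 = u := by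
  have h4 : √(4 : ℝ) = 2 := by
    rw [show (4 : ℝ) = 2 ^ 2 by norm_num]; exact Real.sqrt_sq (by norm_num)
  rw [Real.sqrt_mul (by norm_num), h4]
  nlinarith [Real.mul_self_sqrt hu]

/-- Two renewal models that differ in one pair of waits cannot be predicted by the same
predictor. -/
theorem ageLoss_add_ageLoss_ge {L n i a : ℕ} (hL : 0 < L) (hn : n ≤ L ^ 2) (hi : i < L)
    (ha : a + 1 = L + 2 * i) (han : a < n) {hM : 0 < 2 * L} {T : Finset ℕ} {ν ν' : PMF ℕ}
    (hν : ∀ t, (ν (t + 1)).toReal = tailProb (pairPMF L (2 * L) hM T) t /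
      ∑ s ∈ Finset.range (L + 2 * (2 * L)), tailProb (pairPMF L (2 * L) hM T) s)
    (hν0 : ν 0 = 0)
    (hν' : ∀ t, (ν' (t + 1)).toReal = tailProb (pairPMF L (2 * L) hM (symmDiff T {i})) t /
      ∑ s ∈ Finset.range (L + 2 * (2 * L)), tailProb (pairPMF L (2 * L) hM (symmDiff T {i})) s)
    (q : List Bool → ℝ) :
    (32000 * (L : ℝ) ^ 2)⁻¹ ≤ ageLoss ν (pairPMF L (2 * L) hM T) n a q +
      ageLoss ν' (pairPMF L (2 * L) hM (symmDiff T {i})) n a q := by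
  set μ := pairPMF L (2 * L) hM T with hμ
  set μ' := pairPMF L (2 * L) hM (symmDiff T {i}) with hμ'
  have hL' : (0 : ℝ) < L := by exact_mod_cast hL
  have hμ0 : μ 0 = 0 := pairPMF_of_lt hL
  set D := ∑ s ∈ Finset.range (L + 2 * (2 * L)), tailProb μ s with hD
  set D' := ∑ s ∈ Finset.range (L + 2 * (2 * L)), tailProb μ' s with hD'
  have hDle : D ≤ 5 * L := by
    refine sum_tailProb_pairPMF_le.trans_eq ?_
    push_cast; ring
  have hDge : (L : ℝ) ≤ D := le_sum_tailProb_pairPMF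
  have hDle' : D' ≤ 5 * L := by
    refine sum_tailProb_pairPMF_le.trans_eq ?_
    push_cast; ring
  have hDge' : (L : ℝ) ≤ D' := le_sum_tailProb_pairPMF
  have hD0 : 0 < D := hL'.trans_le hDge
  have hD0' : 0 < D' := hL'.trans_le hDge'
  have hν1 : (ν 1).toReal = 1 / D := by
    rw [← zero_add 1, hν, tailProb_zero hμ0]
  have hst : ∀ t, (ν (t + 1)).toReal = (ν 1).toReal * tailProb μ t := fun t => by
    rw [hν, hν1, one_div_mul_eq_div]
  have hiL : (i : ℝ) + 1 ≤ L := by exact_mod_cast hi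
  have hinv : ((2 * L : ℕ) : ℝ)⁻¹ = 1 / (2 * L) := by push_cast; rw [one_div]
  have htail : ∀ S, tailProb (pairPMF L (2 * L) hM S) a = 1 - i * (1 / (2 * L)) := fun S => by
    rw [tailProb_pairPMF_of_add_one_eq (i := i) (by omega) ha, hinv]
  set τ : ℝ := 1 - i * (1 / (2 * L)) with hτ
  have hτ1 : τ ≤ 1 := by
    rw [hτ, sub_le_self_iff]; positivity
  have hτ2 : 1 / 2 ≤ τ := by
    have : (i : ℝ) * (1 / (2 * L)) ≤ L * (1 / (2 * L)) := by gcongr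
    have h2 : (L : ℝ) * (1 / (2 * L)) = 1 / 2 := by field_simp
    rw [hτ]; linarith
  -- A factor `4` comes from the tails and a factor `5` from the normalizations, which lie in `[L, 5
  -- L]`.
  have hνν : ∀ t, (1 / 20) * (ν t).toReal ≤ (ν' t).toReal := by
    intro t
    cases t with
    | zero => rw [hν0]; simp
    | succ t =>
      rw [hν, hν']
      have h1 : tailProb μ t ≤ 4 * tailProb μ' t := tailProb_pairPMF_le _ t
      have h2 := tailProb_nonneg μ' t
      have h0 := tailProb_nonneg μ t
      calc 1 / 20 * (tailProb μ t / D) ≤ 1 / 20 * (tailProb μ t / L) := by gcongr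
        _ ≤ 1 / 20 * (4 * tailProb μ' t / L) := by gcongr
        _ = tailProb μ' t / (5 * L) := by field_simp; ring
        _ ≤ _ := by gcongr
  have hμμ : ∀ t, t ≠ L + 2 * i → t ≠ L + 2 * i + 1 → μ' t = μ t := by
    intro t h1 h2
    rw [← ENNReal.toReal_eq_toReal_iff' (PMF.apply_ne_top _ _) (PMF.apply_ne_top _ _), hμ, hμ',
      pairPMF_toReal, pairPMF_toReal, pairMass_symmDiff_of_ne h1 h2]
  -- Chosen so that `κ * L` is the mass `1 / (2 L)` of one pair. Then `n ≤ L ^ 2` gives `κ * n ≤ 1 /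
  -- 2`, so the pair is unseen on at least half of the relevant mass.
  set κ : ℝ := 1 / (2 * L ^ 2) with hκ
  have hmass := le_sum_pathProb_not_hasGap (ν := ν) (L := L) (x := L + 2 * i)
    (y := L + 2 * i + 1) (κ := κ) hμ0 hst (by positivity) (fun t ht => pairPMF_of_lt ht)
    (by
      rw [hμ, pairPMF_toReal, pairPMF_toReal, pairMass_even (by omega), pairMass_odd (by omega),
        hinv]
      have : κ * L = 1 / (2 * L) := by rw [hκ]; field_simp
      rw [this]
      split_ifs <;> apply le_of_eq <;> ring) han
  rw [show tailProb μ a = τ from htail T, hν1] at hmass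
  have hκn : κ * n ≤ 1 / 2 := by
    have : (n : ℝ) ≤ (L : ℝ) ^ 2 := by exact_mod_cast hn
    calc κ * n ≤ κ * L ^ 2 := by gcongr
      _ = 1 / 2 := by rw [hκ]; field_simp
  have hgood : (20 * (L : ℝ))⁻¹ ≤ ∑ l ∈ words n, (if l.count true ≠ 0 ∧ age l = a ∧
      ¬ HasGap (L + 2 * i) (L + 2 * i + 1) l then pathProb ν μ l else 0) := by
    refine le_trans ?_ hmass
    calc (20 * (L : ℝ))⁻¹ = 1 / 2 * (1 / (5 * L) * (1 / 2)) := by field_simp; norm_num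
      _ ≤ τ * (1 / D * (1 - κ * n)) := by
        have : 1 / 2 ≤ 1 - κ * n := by linarith
        gcongr
  set h := √((μ (a + 1)).toReal / tailProb μ a) with hh
  set h' := √((μ' (a + 1)).toReal / tailProb μ' a) with hh'
  have hdiff : (10 * (L : ℝ))⁻¹ ≤ (h - h') ^ 2 := by
    -- The hazard at this age is `4 u` in one model and `u` in the other, and `(√(4 u) - √u) ^ 2 =
    -- u`.
    set u : ℝ := 1 / (10 * L) / τ with hu
    have hu0 : 0 ≤ u := by positivity
    have hul : (10 * (L : ℝ))⁻¹ ≤ u := by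
      rw [hu, ← one_div]
      exact le_div_self (by positivity) (by linarith) hτ1
    have e1 : (1 : ℝ) / (2 * L) * (4 / 5) / τ = 4 * u := by rw [hu]; field_simp; norm_num
    have e2 : (1 : ℝ) / (2 * L) * (1 / 5) / τ = u := by rw [hu]; field_simp; norm_num
    have hm : ∀ S, (pairPMF L (2 * L) hM S (a + 1)).toReal / tailProb (pairPMF L (2 * L) hM S) a =
        if i ∈ S then 4 * u else u := fun S => by
      rw [htail, pairPMF_toReal, ha, pairMass_even (by omega), hinv]
      split_ifs
      · exact e1
      · exact e2
    rw [hh, hh', hμ, hμ', hm, hm]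
    by_cases hiT : i ∈ T
    · have : i ∉ symmDiff T {i} := by simp [Finset.mem_symmDiff, hiT]
      rw [if_pos hiT, if_neg this, sq_sqrt_four_mul_sub hu0]
      exact hul
    · have : i ∈ symmDiff T {i} := by simp [Finset.mem_symmDiff, hiT]
      rw [if_neg hiT, if_pos this, ← neg_sub, neg_sq, sq_sqrt_four_mul_sub hu0]
      exact hul
  have hterm : ∀ l ∈ words n, (1 / 80 * ((h - h') ^ 2 / 2)) *
      (if l.count true ≠ 0 ∧ age l = a ∧ ¬ HasGap (L + 2 * i) (L + 2 * i + 1) l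
        then pathProb ν μ l else 0) ≤
      (if l.count true ≠ 0 ∧ age l = a then pathProb ν μ l * (h - q l) ^ 2 else 0) +
      (if l.count true ≠ 0 ∧ age l = a then pathProb ν' μ' l * (h' - q l) ^ 2 else 0) := by
    intro l _
    by_cases h0 : l.count true ≠ 0 ∧ age l = a
    · rw [if_pos h0, if_pos h0]
      have hW := pathProb_nonneg (ν := ν) (μ := μ) l
      have hW' := pathProb_nonneg (ν := ν') (μ := μ') l
      by_cases hg : HasGap (L + 2 * i) (L + 2 * i + 1) l
      · rw [if_neg fun h => h.2.2 hg, mul_zero]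
        positivity
      · rw [if_pos ⟨h0.1, h0.2, hg⟩]
        have h1 := mul_prefixProb_le (by norm_num) hνν hμμ hg
        have h2 : 1 / 80 * pathProb ν μ l ≤ pathProb ν' μ' l := by
          rw [pathProb, pathProb, waitLaw_pos _ _ (Nat.pos_of_ne_zero h0.1),
            waitLaw_pos _ _ (Nat.pos_of_ne_zero h0.1)]
          have h3 : tailProb μ (age l) ≤ 4 * tailProb μ' (age l) := tailProb_pairPMF_le _ _
          have h4 := prefixProb_nonneg (ν := ν) (μ := μ) l
          have h5 := tailProb_nonneg μ' (age l)
          calc 1 / 80 * (prefixProb ν μ l * tailProb μ (age l))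
              ≤ 1 / 80 * (prefixProb ν μ l * (4 * tailProb μ' (age l))) := by gcongr
            _ = 1 / 20 * prefixProb ν μ l * tailProb μ' (age l) := by ring
            _ ≤ _ := by gcongr
        have h3 := mul_sq_add_mul_sq_ge (u := h) (v := h') (q := q l) hW (by norm_num)
          (by norm_num) h2
        linarith
    · rw [if_neg fun h => h0 ⟨h.1, h.2.1⟩, if_neg h0, if_neg h0]
      simp
  have hsum := Finset.sum_le_sum hterm
  rw [← Finset.mul_sum, Finset.sum_add_distrib] at hsum
  refine le_trans ?_ hsum
  calc (32000 * (L : ℝ) ^ 2)⁻¹ = 1 / 80 * ((10 * (L : ℝ))⁻¹ / 2) * (20 * (L : ℝ))⁻¹ := by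
        field_simp; norm_num
    _ ≤ _ := by gcongr

/-- A sum over subsets is bounded below by pairing each subset with its flips. -/
theorem mul_le_of_flip {K : ℕ} {A : Finset ℕ → ℕ → ℝ} {β V : ℝ}
    (hA : ∀ T, ∀ i < K, β ≤ A T i + A (symmDiff T {i}) i)
    (hV : ∀ T, ∑ i ∈ Finset.range K, A T i ≤ V) : K * β ≤ 2 * V := by
  set S := (Finset.range K).powerset with hS
  -- Flipping `i` is an involution of the power set, so averaged over `T` the `i`-th loss is at
  -- least `β / 2`.
  have hflip : ∀ i < K, ∑ T ∈ S, A (symmDiff T {i}) i = ∑ T ∈ S, A T i := by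
    intro i hi
    have hmem : ∀ T ∈ S, symmDiff T {i} ∈ S := by
      intro T hT
      rw [hS, Finset.mem_powerset] at hT ⊢
      intro j hj
      rw [Finset.mem_symmDiff, Finset.mem_singleton] at hj
      rcases hj with hj | hj
      · exact hT hj.1
      · rw [hj.1]; exact Finset.mem_range.2 hi
    exact Finset.sum_nbij' (fun T => symmDiff T {i}) (fun T => symmDiff T {i}) hmem hmem
      (fun T _ => symmDiff_symmDiff_cancel_right _ _)
      (fun T _ => symmDiff_symmDiff_cancel_right _ _) fun _ _ => rfl
  have h1 : ∀ i ∈ Finset.range K, (S.card : ℝ) * β ≤ 2 * ∑ T ∈ S, A T i := by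
    intro i hi
    rw [Finset.mem_range] at hi
    rw [two_mul]
    nth_rewrite 2 [← hflip i hi]
    rw [← Finset.sum_add_distrib, ← nsmul_eq_mul]
    exact Finset.card_nsmul_le_sum _ _ _ fun T _ => hA T i hi
  have h2 := Finset.card_nsmul_le_sum _ _ _ h1
  rw [← Finset.mul_sum, Finset.sum_comm, Finset.card_range, nsmul_eq_mul] at h2
  have h3 := Finset.sum_le_card_nsmul S _ _ fun T _ => hV T
  rw [nsmul_eq_mul] at h3
  have h4 : (0 : ℝ) < S.card := by
    exact_mod_cast Finset.card_pos.2 ⟨∅, by simp [hS]⟩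
  refine le_of_mul_le_mul_left ?_ h4
  linarith

theorem le_worstCaseRisk {n : ℕ} (hn : 1 ≤ n) (Q : Kernel (Fin n → Bool) Bool) [IsMarkovKernel Q] :
    ENNReal.ofReal ((512000 : ℝ)⁻¹ * √((n : ℝ)⁻¹)) ≤ worstCaseRisk Q (renewalClass n) := by
  -- This is `√n` rounded up, so that `n ≤ L ^ 2` and still `L ≤ 2 √n`.
  set L := Nat.sqrt (n - 1) + 1 with hL
  have hL0 : 0 < L := Nat.succ_pos _
  have hM : 0 < 2 * L := by omega
  have hnL : n ≤ L ^ 2 := by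
    have := Nat.lt_succ_sqrt (n - 1)
    rw [sq, hL]; simp only [Nat.succ_eq_add_one] at this; omega
  have hLn : (L - 1) * (L - 1) ≤ n - 1 := Nat.sqrt_le (n - 1)
  -- Only `L / 4` pairs, rounded up, are used: their waits must fit into `n` even for small `n`, and
  -- at least half of the mass must lie at or beyond each of them.
  set K := (L + 3) / 4 with hK
  have hKn : ∀ i < K, L + 2 * i ≤ n := by
    intro i hi
    obtain ⟨r, hr⟩ : ∃ r, L = r + 1 := ⟨L - 1, by omega⟩
    rw [hr, Nat.add_sub_cancel] at hLn
    rcases Nat.lt_or_ge r 2 with h | h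
    · interval_cases r <;> omega
    · have : r * r ≥ 2 * r := Nat.mul_le_mul_right r h
      omega
  have hinit : ∀ T, ∃ ν : PMF ℕ, ν 0 = 0 ∧ ∀ t, (ν (t + 1)).toReal =
      tailProb (pairPMF L (2 * L) hM T) t /
        ∑ s ∈ Finset.range (L + 2 * (2 * L)), tailProb (pairPMF L (2 * L) hM T) s := by
    intro T
    have := exists_stationary_initial (μ := pairPMF L (2 * L) hM T) (B := L + 2 * (2 * L) - 1)
      (pairPMF_of_lt hL0) (by
        rw [tailProb_pairPMF_of_add_one_eq (i := 2 * L) le_rfl (by omega),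
          mul_inv_cancel₀ (by exact_mod_cast hM.ne'), sub_self])
    rwa [show L + 2 * (2 * L) - 1 + 1 = L + 2 * (2 * L) by omega] at this
  choose ν hν0 hν using hinit
  rcases eq_or_ne (worstCaseRisk Q (renewalClass n)) ∞ with htop | htop
  -- Infinite risk is set aside because `toReal` would turn it into zero.
  · rw [htop]; exact le_top
  set q : List Bool → ℝ := fun l => √((Q fun j => l.reverse.getD j true).real {true}) with hq
  have hV : ∀ T, ∑ i ∈ Finset.range K,
      ageLoss (ν T) (pairPMF L (2 * L) hM T) n (L + 2 * i - 1) q ≤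
        (worstCaseRisk Q (renewalClass n)).toReal := by
    intro T
    set μ := pairPMF L (2 * L) hM T with hμ
    have hμ0 : μ 0 = 0 := pairPMF_of_lt hL0
    have hst : ∀ t, ((ν T) (t + 1)).toReal = ((ν T) 1).toReal * tailProb μ t := fun t => by
      have h1 := hν T 0
      rw [zero_add, tailProb_zero hμ0] at h1
      rw [hν, h1, one_div_mul_eq_div]
    set P : ProbabilityMeasure (Fin (n + 1) → Bool) :=
      ⟨(renewalLaw (ν T) μ).map (fun (x : ℕ → Bool) (i : Fin (n + 1)) => x i),
        Measure.isProbabilityMeasure_map (Measurable.aemeasurable (by fun_prop))⟩ with hP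
    have hPmem : P ∈ renewalClass n :=
      ⟨ν T, μ, hν0 T, hμ0, tsum_mul_pairPMF_lt_top,
        isStationaryLaw_of_pathProb_append (hν0 T) hμ0 (pathProb_append hst), rfl⟩
    have h1 := ageLoss_le_predictionRiskAt (hν0 T) hμ0 Q P rfl (Finset.range K)
      (a := fun i => L + 2 * i - 1) fun i j hij => by dsimp only at hij; omega
    have h2 : predictionRiskAt Q P ≤ worstCaseRisk Q (renewalClass n) :=
      le_iSup₂ (f := fun P (_ : P ∈ renewalClass n) => predictionRiskAt Q P) P hPmem
    exact (ENNReal.ofReal_le_iff_le_toReal htop).1 (h1.trans h2)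
  have hmain := mul_le_of_flip (K := K)
    (A := fun T i => ageLoss (ν T) (pairPMF L (2 * L) hM T) n (L + 2 * i - 1) q)
    (fun T i hi => ageLoss_add_ageLoss_ge (ν := ν T) (ν' := ν (symmDiff T {i})) hL0 hnL
      (show i < L by omega) (show L + 2 * i - 1 + 1 = L + 2 * i by omega)
      (by have := hKn i hi; omega) (hν T) (hν0 T) (hν (symmDiff T {i})) q) hV
  refine (ENNReal.ofReal_le_iff_le_toReal htop).2 ?_
  set V := (worstCaseRisk Q (renewalClass n)).toReal
  have hL' : (0 : ℝ) < L := by exact_mod_cast hL0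
  have hn' : (1 : ℝ) ≤ n := by exact_mod_cast hn
  have hK4 : (L : ℝ) ≤ 4 * K := by
    have : L ≤ 4 * K := by omega
    exact_mod_cast this
  have hLs : (L : ℝ) ≤ 2 * √n := by
    have h1 : (1 : ℝ) ≤ √n := Real.one_le_sqrt.2 hn'
    have h2 : ((L : ℝ) - 1) ≤ √n := by
      refine Real.le_sqrt_of_sq_le ?_
      have h3 : (((L - 1) * (L - 1) : ℕ) : ℝ) ≤ ((n - 1 : ℕ) : ℝ) := by exact_mod_cast hLn
      rw [Nat.cast_mul, Nat.cast_sub hL0, Nat.cast_sub hn] at h3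
      push_cast at h3
      rw [sq]; linarith
    linarith
  rw [Real.sqrt_inv]
  -- The constant is `32000 * 4 * 2 * 2`: the cost of one pair, the count `K ≥ L / 4`, the halving
  -- from flips, and `L ≤ 2 √n`.
  calc (512000 : ℝ)⁻¹ * (√n)⁻¹ = 1 / (256000 * (2 * √n)) := by
        rw [one_div, ← mul_inv]; congr 1; ring
    _ ≤ 1 / (256000 * L) := by gcongr
    _ = L / 4 * (32000 * (L : ℝ) ^ 2)⁻¹ / 2 := by field_simp; norm_num
    _ ≤ K * (32000 * (L : ℝ) ^ 2)⁻¹ / 2 := by gcongr; linarith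
    _ ≤ V := by linarith

theorem le_renewalRisk {n : ℕ} (hn : 1 ≤ n) :
    ENNReal.ofReal ((512000 : ℝ)⁻¹ * √((n : ℝ)⁻¹)) ≤ renewalRisk n :=
  le_iInf₂ fun Q _ => le_worstCaseRisk hn Q

theorem theorem4 :
    ∃ C : ℝ, 0 < C ∧ ∀ n : ℕ, 1 ≤ n →
      ENNReal.ofReal (C⁻¹ * √((n : ℝ)⁻¹)) ≤ renewalRisk n ∧
      renewalRisk n ≤ ENNReal.ofReal (C * √((n : ℝ)⁻¹)) := by
  refine ⟨512000, by norm_num, fun n hn => ⟨le_renewalRisk hn, (renewalRisk_le hn).trans ?_⟩⟩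
  refine ENNReal.ofReal_le_ofReal ?_
  gcongr
  norm_num

end
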